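/- Let $\mathcal A$ be a von Neumann algebra with a faithful tracial state $\varphi$, and let $p_1,\dots,p_d\in\mathcal A$ be non-zero, pairwise orthogonal, self-adjoint projections with $p_1+\cdots+p_d=1$. Put $\rho_k=\varphi(p_k)$, $\varphi_k(a)=\varphi(p_kap_k)/\rho_k$, $\mathcal A_{kl}=p_k\mathcal A p_l$, $\mathcal D=\operatorname{Span}\{p_1,\dots,p_d\}$ and $E(a)=\sum_k\varphi_k(a)p_k$. Let $L^2(\mathcal A)$ be the completion of $\mathcal A$ for $\|a\|_2=\varphi(aa^*)^{1/2}$, on which $\mathcal A$ acts on the left and on the right, and extend each $\varphi_k$ to it continuously. Let $(a_i)_{i\in I}$ be a family, closed under adjoints, of non-zero elements $a_i\in\mathcal A_{r(i),c(i)}$. A *conjugate system* for $(a_i)$ is a family of non-zero elements $\xi_i\in p_{c(i)}L^2(\mathcal A)p_{r(i)}$ lying in the $\|\cdot\|_2$-closure of the algebra generated by $\{a_j: j\in I\}\cup\mathcal D$ such that for all $n\ge 0$ and $i,i_1,\dots,i_n\in I$ for which the column index of each entry of $(\xi_i,a_{i_1},\dots,a_{i_n})$ equals the row index of the next one (cyclically),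 $$\varphi_{c(i)}(\xi_i a_{i_1}\cdots a_{i_n})=\sum_{m=1}^n\delta_{i,i_m}\,\varphi_{r(i)}(a_{i_1}\cdots a_{i_{m-1}})\,\varphi_{c(i)}(a_{i_{m+1}}\cdots a_{i_n}),$$ where empty products are read as $1$. A conjugate system is unique if it exists. Set $\Phi_r((a_i)_{i\in I})=\sum_i\|\xi_i\|_2^2$ if $(\xi_i)$ is a conjugate system, and $\Phi_r((a_i)_{i\in I})=\infty$ if there is none. Two subsets of $\mathcal A$ are *free with amalgamation over $\mathcal D$* if they are contained in subalgebras $\mathcal A_1,\mathcal A_2\supset\mathcal D$ such that $E(z_1\cdots z_n)=0$ whenever $n\ge1$, $z_j\in\mathcal A_{i_j}$, $E(z_j)=0$ for all $j$, and $i_j\ne i_{j+1}$ for $1\le j<n$. Two elements $x,y$ are said to be free with amalgamation over $\mathcal D$ if the sets $\{x,x^*\}$ and $\{y,y^*\}$ are. **Theorem.** Let $x,y$ be non-zero elements of $\mathcal A_{kl}$ with $k\neq l$. Then $$\Phi_r(x,y,x^*,y^*)\ \ge\ \Phi_r(x,x^*)+\Phi_r(y,y^*),$$ with equality if $x,y$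 are free with amalgamation over $\mathcal D$. Conversely, if $$\Phi_r(x,y,x^*,y^*)=\Phi_r(x,x^*)+\Phi_r(y,y^*)<\infty,$$ then $x,y$ are free with amalgamation over $\mathcal D$. -/

import Mathlib

open scoped ComplexOrder InnerProductSpace ENNReal

noncomputable section

/-- A faithful tracial state `φ` on `A` together with nonzero, pairwise orthogonal, self-adjoint
projections `p 0, …, p (d - 1)` of `A` whose sum is `1`. -/
structure RectSpace (A : Type*) [CStarAlgebra A] [PartialOrder A] [StarOrderedRing A] (d : ℕ) where
  /-- the state, as a positive linear functional -/
  φ : A →ₚ[ℂ] ℂ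
  map_one : φ 1 = 1
  tracial : ∀ a b, φ (a * b) = φ (b * a)
  faithful : ∀ a, φ (star a * a) = 0 → a = 0
  /-- the projections -/
  p : Fin d → A
  isStarProjection : ∀ i, IsStarProjection (p i)
  orthogonal : ∀ i j, i ≠ j → p i * p j = 0
  ne_zero : ∀ i, p i ≠ 0
  sum_eq_one : ∑ i, p i = 1

namespace RectSpace

variable {A : Type*} [CStarAlgebra A] [PartialOrder A] [StarOrderedRing A] {d : ℕ}
  (S : RectSpace A d)

/-- The corner `p k A p l`. As `p k` and `p l` are idempotent, it consists of the elements `a`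
with `p k * a * p l = a`. -/
def corner (k l : Fin d) : Set A := {a | S.p k * a * S.p l = a}

/-- The linear span `𝒟` of the projections. -/
def D : Submodule ℂ A := Submodule.span ℂ (Set.range S.p)

/-- The normalized functional `φ_k = φ (p k · p k) / ρ_k`, where `ρ_k = φ (p k)`. -/
def phi (k : Fin d) (a : A) : ℂ := S.φ (S.p k * a * S.p k) / S.φ (S.p k)

/-- The conditional expectation onto `𝒟`: `diag (φ_1 (a_11), …, φ_d (a_dd))`. -/
def E (a : A) : A := ∑ k, S.phi k a • S.p k

/-! ### Freeness with amalgamation over `𝒟` -/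

/-- Freeness with amalgamation over `𝒟` of a family of subalgebras which contain `𝒟`. -/
def FreeSubalgebras {J : Type*} (B : J → Subalgebra ℂ A) : Prop :=
  (∀ j, (S.D : Set A) ⊆ B j) ∧
  ∀ (n : ℕ) (j : Fin (n + 1) → J) (z : Fin (n + 1) → A),
    (∀ i : Fin n, j i.castSucc ≠ j i.succ) →
    (∀ i, z i ∈ B (j i)) → (∀ i, S.E (z i) = 0) →
    S.E (List.ofFn z).prod = 0

/-- Freeness with amalgamation over `𝒟` of a family of subsets. -/
def FreeSets {J : Type*} (χ : J → Set A) : Prop :=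
  ∃ B : J → Subalgebra ℂ A, (∀ j, χ j ⊆ B j) ∧ S.FreeSubalgebras B

/-- Freeness with amalgamation over `𝒟` of two elements `x`, `y`, in the `*`-sense: the sets
`{x, x*}` and `{y, y*}` are free with amalgamation over `𝒟`. -/
def FreePair (x y : A) : Prop := S.FreeSets ![{x, star x}, {y, star y}]

/-! ### The Hilbert space `L²` and its bimodule structure -/

/-- The Hilbert space `L²(A)`: the completion of `A` for the inner product `φ (a* b)`. -/
abbrev L2 : Type _ := S.φ.GNS

/-- The canonical map `A → L²(A)`. -/
def toL2 (a : A) : S.L2 := ((S.φ.toPreGNS a : S.φ.PreGNS) : UniformSpace.Completion S.φ.PreGNS)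

/-- The left action of `A` on `L²(A)`. -/
def lmul (a : A) : S.L2 →L[ℂ] S.L2 := S.φ.gnsStarAlgHom a

theorem norm_toPreGNS_star (a : A) : ‖S.φ.toPreGNS (star a)‖ = ‖S.φ.toPreGNS a‖ := by
  simp [PositiveLinearMap.preGNS_norm_def, S.tracial a (star a)]

/-- Right multiplication by `b`, on `A` with the norm of `L²(A)`. -/
def rmulPre (b : A) : S.φ.PreGNS →L[ℂ] S.φ.PreGNS :=
  (S.φ.toPreGNS.toLinearMap ∘ₗ LinearMap.mulRight ℂ b ∘ₗ S.φ.ofPreGNS.toLinearMap).mkContinuous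
    ‖S.φ.leftMulMapPreGNS (star b)‖ fun x ↦ by
      have h := (S.φ.leftMulMapPreGNS (star b)).le_opNorm (S.φ.toPreGNS (star (S.φ.ofPreGNS x)))
      rw [S.norm_toPreGNS_star, PositiveLinearMap.toPreGNS_ofPreGNS] at h
      have e : S.φ.leftMulMapPreGNS (star b) (S.φ.toPreGNS (star (S.φ.ofPreGNS x)))
          = S.φ.toPreGNS (star (S.φ.ofPreGNS x * b)) := by simp
      rw [e, S.norm_toPreGNS_star] at h
      simpa using h

/-- The right action of `A` on `L²(A)`: `rmul b ξ` is `ξ b`. -/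
def rmul (b : A) : S.L2 →L[ℂ] S.L2 := (S.rmulPre b).completion

theorem lmul_toL2 (a b : A) : S.lmul a (S.toL2 b) = S.toL2 (a * b) := by
  simp [lmul, toL2]

theorem rmul_toL2 (a b : A) : S.rmul b (S.toL2 a) = S.toL2 (a * b) := by
  simp [rmul, rmulPre, toL2]

theorem inner_toL2 (a b : A) : ⟪S.toL2 a, S.toL2 b⟫_ℂ = S.φ (star a * b) := by
  simp [toL2, PositiveLinearMap.preGNS_inner_def]

/-- The corner `p k L²(A) p l`, as the set of `ξ` with `p k ξ p l = ξ`. -/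
def cornerL2 (k l : Fin d) : Set S.L2 := {ξ | S.lmul (S.p k) (S.rmul (S.p l) ξ) = ξ}

/-- The continuous extension of `φ_k` to `L²(A)`. On `L²(A)`, `φ` extends to `⟪1, ·⟫`. -/
def phiL2 (k : Fin d) (ξ : S.L2) : ℂ :=
  ⟪S.toL2 1, S.lmul (S.p k) (S.rmul (S.p k) ξ)⟫_ℂ / S.φ (S.p k)

theorem phiL2_toL2 (k : Fin d) (a : A) : S.phiL2 k (S.toL2 a) = S.phi k a := by
  simp [phiL2, phi, lmul_toL2, rmul_toL2, inner_toL2, mul_assoc]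

/-! ### Conjugate systems and Fisher's information -/

/-- `IsPath r c s w t`: the indices in the word `w` have types that can be composed, starting from
row `s` and ending at column `t` (for the empty word: `s = t`). -/
def IsPath {I : Type*} (r c : I → Fin d) : Fin d → List I → Fin d → Prop
  | s, [], t => s = t
  | s, i :: w, t => r i = s ∧ IsPath r c (c i) w t

/-- The conjugate relations for a family `a` of simple elements, `a i ≠ 0` in the corner
`(r i, c i)`: each `ξ i` is a simple element of the corner `(c i, r i)` of `L²(A)`, and for every
word `w = i_1 … i_n`, `n ≥ 0`, such that `(ξ i, a i_1, …, a i_n)` is a square sequence,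
`φ_{c i} (ξ_i a_{i_1} ⋯ a_{i_n})
  = ∑ m, δ_{i, i_m} φ_{r i} (a_{i_1} ⋯ a_{i_{m-1}}) φ_{c i} (a_{i_{m+1}} ⋯ a_{i_n})`. -/
def ConjugateRelations {I : Type*} [DecidableEq I] (a : I → A) (ξ : I → S.L2) : Prop :=
  ∃ r c : I → Fin d,
    (∀ i, a i ≠ 0 ∧ a i ∈ S.corner (r i) (c i)) ∧
    (∀ i, ξ i ≠ 0 ∧ ξ i ∈ S.cornerL2 (c i) (r i)) ∧
    ∀ (i : I) (w : List I), IsPath r c (r i) w (c i) →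
      S.phiL2 (c i) (S.rmul (w.map a).prod (ξ i)) =
        ∑ m : Fin w.length, if i = w.get m then
          S.phi (r i) ((w.take m).map a).prod * S.phi (c i) ((w.drop (m + 1)).map a).prod
        else 0

/-- A conjugate system for `a`: it satisfies the conjugate relations and lies in the closure in
`L²(A)` of the algebra generated by the `a i` and `𝒟`. -/
def IsConjugateSystem {I : Type*} [DecidableEq I] (a : I → A) (ξ : I → S.L2) : Prop :=
  S.ConjugateRelations a ξ ∧
  ∀ i, ξ i ∈ closure (S.toL2 '' (Algebra.adjoin ℂ (Set.range a ∪ (S.D : Set A)) : Set A))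

open Classical in
/-- Fisher's information `Φ_r` of a self-adjoint family of simple elements: `∑ i, ‖ξ i‖²` if `ξ` is
a conjugate system (it is then unique), and `∞` if there is no conjugate system. -/
def fisher {I : Type*} [DecidableEq I] (a : I → A) : ℝ≥0∞ :=
  if h : ∃ ξ : I → S.L2, S.IsConjugateSystem a ξ then
    ∑' i, ENNReal.ofReal (‖h.choose i‖ ^ 2)
  else ∞

end RectSpace

end

/-! The conjugate relations say that the functional `u ↦ φ (ξ i u)`, scaled by `φ (p (r i))`, is `φ
⊗ φ` composed with a free difference quotient ∂_i. This ∂_i is the derivation that kills the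
projections and sends a_j to δ_ij p_{r(i)} ⊗ p_{c(i)}. It is defined on a free algebra, because the
a_j may satisfy relations in `A`. `conjRel_of_words` extends the relations from composable words to
all polynomials.

Inequality: projecting a conjugate system of x, y, x*, y* onto the L²-closures of the algebras of
{x, x*} and {y, y*} gives the conjugate systems of these pairs (`IsConjugateSystem.restrict`), and
projections do not increase norms.

Equality under freeness: the free algebra is spanned by the letters of the projections and by
alternating products of centered polynomials (`span_alt_eq_top`). On such a product, apart from a
single factor in the colour of i, both sides of the relation for ξ_i vanish by freeness
(`FreeSubalgebras.conjRel`). Hence the two conjugate systems together form one for the union.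

Converse: equality of finite sums forces the projections to fix the vectors ξ, so those of x and x*
lie in the closure of the algebra of {x, x*}. Consider the derivation δ that vanishes on y, y* and
is the commutator with ∑ p_t ⊗ p_t on the algebra of {x, x*}. The relations turn (φ ⊗ φ) ∘ δ into
the pairing with a weighted sum of commutators [a_i, ξ_i]. That sum lies in the closure of the
algebra of {x, x*} and pairs to zero with this algebra, so it is 0 and (φ ⊗ φ) ∘ δ = 0 everywhere.
Expanding δ on alternating centered products then gives freeness by induction on their length
(`freeSubalgebras_of_trace₂_liberation`). -/

noncomputable section

open scoped TensorProduct

namespace RectSpace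

variable {A : Type*} [CStarAlgebra A] [PartialOrder A] [StarOrderedRing A] {d : ℕ}
  (S : RectSpace A d)

/-! ### The projections and the conditional expectation -/

theorem p_mul_p (i j : Fin d) : S.p i * S.p j = if i = j then S.p i else 0 := by
  split_ifs with h
  · subst h; exact (S.isStarProjection i).isIdempotentElem
  · exact S.orthogonal i j h

@[simp] theorem p_mul_self (i : Fin d) : S.p i * S.p i = S.p i := by simp [p_mul_p]

@[simp] theorem star_p (i : Fin d) : star (S.p i) = S.p i := (S.isStarProjection i).isSelfAdjoint

theorem φ_p_ne_zero (i : Fin d) : S.φ (S.p i) ≠ 0 := by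
  intro h
  exact S.ne_zero i (S.faithful _ (by simpa using h))

theorem p_mem_D (i : Fin d) : S.p i ∈ S.D := Submodule.subset_span ⟨i, rfl⟩

theorem φ_smul (t : ℂ) (a : A) : S.φ (t • a) = t * S.φ a := by simp

theorem φ_p_mul_p (i : Fin d) (a : A) : S.φ (S.p i * a * S.p i) = S.φ (S.p i * a) := by
  rw [S.tracial, ← mul_assoc, p_mul_self]

theorem phi_mul (i : Fin d) (a : A) : S.φ (S.p i) * S.phi i a = S.φ (S.p i * a) := by
  rw [phi, mul_div_cancel₀ _ (S.φ_p_ne_zero i), φ_p_mul_p]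

theorem E_eq_zero_iff (a : A) : S.E a = 0 ↔ ∀ i, S.φ (S.p i * a) = 0 := by
  constructor
  · intro h i
    have h2 : S.p i * S.E a = S.phi i a • S.p i := by
      simp [E, Finset.mul_sum, p_mul_p]
    rw [h, mul_zero] at h2
    have : S.phi i a = 0 := by
      rcases smul_eq_zero.1 h2.symm with h | h
      · exact h
      · exact absurd h (S.ne_zero i)
    rw [← phi_mul, this, mul_zero]
  · intro h
    refine Finset.sum_eq_zero fun i _ ↦ ?_
    rw [phi, φ_p_mul_p, h]; simp

theorem φ_eq_sum (a : A) : S.φ a = ∑ i, S.φ (S.p i * a) := by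
  rw [← map_sum, ← Finset.sum_mul, S.sum_eq_one, one_mul]

theorem φ_eq_zero_of_E {a : A} (h : S.E a = 0) : S.φ a = 0 := by
  rw [φ_eq_sum]; exact Finset.sum_eq_zero fun i _ ↦ (S.E_eq_zero_iff a).1 h i

theorem E_mem_D (a : A) : S.E a ∈ S.D :=
  Submodule.sum_mem _ fun i _ ↦ Submodule.smul_mem _ _ (S.p_mem_D i)

theorem E_sub_E (a : A) : S.E (a - S.E a) = 0 := by
  rw [E_eq_zero_iff]
  intro i
  have h2 : S.p i * S.E a = S.phi i a • S.p i := by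
    simp [E, Finset.mul_sum, p_mul_p]
  rw [mul_sub, h2, map_sub, φ_smul, mul_comm, phi_mul, sub_self]

theorem E_add (a b : A) (ha : S.E a = 0) (hb : S.E b = 0) : S.E (a + b) = 0 := by
  rw [E_eq_zero_iff] at *
  intro i; rw [mul_add, map_add, ha, hb, add_zero]

theorem E_smul (t : ℂ) (a : A) (ha : S.E a = 0) : S.E (t • a) = 0 := by
  rw [E_eq_zero_iff] at *
  intro i; rw [mul_smul_comm, φ_smul, ha, mul_zero]

theorem E_p_mul (i : Fin d) {a : A} (ha : S.E a = 0) : S.E (S.p i * a) = 0 := by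
  rw [E_eq_zero_iff] at *
  intro j
  rw [← mul_assoc, p_mul_p]
  split_ifs <;> simp [ha]

theorem E_mul_p (i : Fin d) {a : A} (ha : S.E a = 0) : S.E (a * S.p i) = 0 := by
  rw [E_eq_zero_iff] at *
  intro j
  rw [← mul_assoc, S.tracial, ← mul_assoc, p_mul_p]
  split_ifs <;> simp [ha]

/-- The kernel of `E`, as a submodule. -/
def kerE : Submodule ℂ A where
  carrier := {a | S.E a = 0}
  add_mem' ha hb := S.E_add _ _ ha hb
  zero_mem' := by simp [E, phi]
  smul_mem' t a ha := S.E_smul t a ha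

theorem E_mul_of_mem_D_left {e a : A} (he : e ∈ S.D) (ha : S.E a = 0) : S.E (e * a) = 0 := by
  have : S.D ≤ S.kerE.comap (LinearMap.mulRight ℂ a) :=
    Submodule.span_le.2 (by rintro _ ⟨i, rfl⟩; exact S.E_p_mul i ha)
  exact this he

theorem E_mul_of_mem_D_right {e a : A} (he : e ∈ S.D) (ha : S.E a = 0) : S.E (a * e) = 0 := by
  have : S.D ≤ S.kerE.comap (LinearMap.mulLeft ℂ a) :=
    Submodule.span_le.2 (by rintro _ ⟨i, rfl⟩; exact S.E_mul_p i ha)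
  exact this he

/-- Row and column indices are only existentially bound in `ConjugateRelations`; this makes those of
two systems for the same elements agree. -/
theorem corner_unique {a : A} (ha : a ≠ 0) {k l k' l' : Fin d} (h : a ∈ S.corner k l)
    (h' : a ∈ S.corner k' l') : k = k' ∧ l = l' := by
  have h1 : S.p k * a * S.p l = a := h
  have h2 : S.p k' * a * S.p l' = a := h'
  constructor <;> by_contra hn <;> apply ha
  · rw [← h2, ← h1]
    simp only [← mul_assoc]
    rw [S.orthogonal _ _ (Ne.symm hn)]; simp
  · rw [← h2, ← h1]
    simp only [mul_assoc]
    rw [S.orthogonal _ _ hn]; simp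

theorem p_mul_of_mem_corner {a : A} {k l : Fin d} (h : a ∈ S.corner k l) : S.p k * a = a := by
  have h1 : S.p k * a * S.p l = a := h
  nth_rw 1 [← h1]; rw [← mul_assoc, ← mul_assoc, p_mul_self, h1]

theorem mul_p_of_mem_corner {a : A} {k l : Fin d} (h : a ∈ S.corner k l) : a * S.p l = a := by
  have h1 : S.p k * a * S.p l = a := h
  nth_rw 1 [← h1]; rw [mul_assoc, p_mul_self, h1]

theorem star_mem_corner {a : A} {k l : Fin d} (h : a ∈ S.corner k l) :
    star a ∈ S.corner l k := by
  have h1 : S.p k * a * S.p l = a := h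
  change S.p l * star a * S.p k = star a
  nth_rw 2 [← h1]; simp [mul_assoc]

/-! ### The pairing of `L²(A)` with `A` -/

theorem toL2_add (a b : A) : S.toL2 (a + b) = S.toL2 a + S.toL2 b := by
  simp [toL2, UniformSpace.Completion.coe_add]

theorem toL2_smul (t : ℂ) (a : A) : S.toL2 (t • a) = t • S.toL2 a := by
  simp [toL2]

/-- `toL2` as a linear map. -/
def toL2ₗ : A →ₗ[ℂ] S.L2 where
  toFun := S.toL2
  map_add' := S.toL2_add
  map_smul' := S.toL2_smul

@[simp] theorem toL2ₗ_apply (a : A) : S.toL2ₗ a = S.toL2 a := rfl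

theorem denseRange_toL2 : DenseRange S.toL2 :=
  UniformSpace.Completion.denseRange_coe.comp S.φ.toPreGNS.surjective.denseRange
    (UniformSpace.Completion.continuous_coe _)

theorem inner_lmul (a b : A) (ζ : S.L2) :
    ⟪S.toL2 a, S.lmul b ζ⟫_ℂ = ⟪S.toL2 (star b * a), ζ⟫_ℂ := by
  refine S.denseRange_toL2.induction_on (p := fun ζ ↦ ⟪S.toL2 a, S.lmul b ζ⟫_ℂ =
    ⟪S.toL2 (star b * a), ζ⟫_ℂ) ζ (isClosed_eq (by fun_prop) (by fun_prop)) fun c ↦ ?_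
  simp [lmul_toL2, inner_toL2, mul_assoc]

theorem inner_rmul (a b : A) (ζ : S.L2) :
    ⟪S.toL2 a, S.rmul b ζ⟫_ℂ = ⟪S.toL2 (a * star b), ζ⟫_ℂ := by
  refine S.denseRange_toL2.induction_on (p := fun ζ ↦ ⟪S.toL2 a, S.rmul b ζ⟫_ℂ =
    ⟪S.toL2 (a * star b), ζ⟫_ℂ) ζ (isClosed_eq (by fun_prop) (by fun_prop)) fun c ↦ ?_
  simp only [rmul_toL2, inner_toL2, star_mul, star_star]
  rw [← mul_assoc, S.tracial, mul_assoc]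

/-- The functional `u ↦ φ (ξ u)` of a vector `ξ` of `L²(A)`. -/
def pairing (ξ : S.L2) : A →ₗ[ℂ] ℂ where
  toFun u := ⟪S.toL2 (star u), ξ⟫_ℂ
  map_add' u v := by rw [star_add, toL2_add, inner_add_left]
  map_smul' t u := by rw [star_smul, toL2_smul, inner_smul_left]; simp

theorem pairing_apply (ξ : S.L2) (u : A) : S.pairing ξ u = ⟪S.toL2 (star u), ξ⟫_ℂ := rfl

theorem pairing_toL2 (b u : A) : S.pairing (S.toL2 b) u = S.φ (b * u) := by
  rw [pairing_apply, inner_toL2, star_star, S.tracial]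

theorem pairing_lmul (b : A) (ξ : S.L2) (u : A) :
    S.pairing (S.lmul b ξ) u = S.pairing ξ (u * b) := by
  rw [pairing_apply, inner_lmul, pairing_apply, star_mul]

theorem pairing_rmul (b : A) (ξ : S.L2) (u : A) :
    S.pairing (S.rmul b ξ) u = S.pairing ξ (b * u) := by
  rw [pairing_apply, inner_rmul, pairing_apply, star_mul]

theorem pairing_cornerL2 {ξ : S.L2} {k l : Fin d} (h : ξ ∈ S.cornerL2 k l) (u : A) :
    S.pairing ξ u = S.pairing ξ (S.p l * u * S.p k) := by
  have h1 : S.lmul (S.p k) (S.rmul (S.p l) ξ) = ξ := h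
  nth_rw 1 [← h1]
  rw [pairing_lmul, pairing_rmul, mul_assoc]

theorem continuous_pairing (u : A) : Continuous fun ξ ↦ S.pairing ξ u := by
  simp only [pairing_apply]; fun_prop

theorem phiL2_rmul (k : Fin d) (ξ : S.L2) (u : A) :
    S.φ (S.p k) * S.phiL2 k (S.rmul u ξ) = S.pairing ξ (u * S.p k) := by
  rw [phiL2, mul_div_cancel₀ _ (S.φ_p_ne_zero k), ← star_one A, ← pairing_apply, pairing_lmul,
    pairing_rmul, pairing_rmul]
  simp

/-! ### The closure in `L²(A)` of a subalgebra -/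

/-- The closure of a subalgebra of `A` in `L²(A)`. -/
def closureL2 (B : Subalgebra ℂ A) : Submodule ℂ S.L2 :=
  (B.toSubmodule.map S.toL2ₗ).topologicalClosure

theorem isClosed_closureL2 (B : Subalgebra ℂ A) : IsClosed (S.closureL2 B : Set S.L2) :=
  Submodule.isClosed_topologicalClosure _

instance (B : Subalgebra ℂ A) : CompleteSpace (S.closureL2 B) :=
  (S.isClosed_closureL2 B).completeSpace_coe

theorem toL2_mem_closureL2 {B : Subalgebra ℂ A} {b : A} (hb : b ∈ B) :
    S.toL2 b ∈ S.closureL2 B :=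
  Submodule.le_topologicalClosure _ ⟨b, hb, rfl⟩

theorem closureL2_mono {B C : Subalgebra ℂ A} (h : B ≤ C) : S.closureL2 B ≤ S.closureL2 C :=
  Submodule.topologicalClosure_mono (Submodule.map_mono h)

theorem map_mem_closureL2 {B : Subalgebra ℂ A} (T : S.L2 →L[ℂ] S.L2)
    (hT : ∀ b ∈ B, T (S.toL2 b) ∈ S.closureL2 B) {ξ : S.L2} (hξ : ξ ∈ S.closureL2 B) :
    T ξ ∈ S.closureL2 B := by
  have : closure (S.toL2 '' (B : Set A)) ⊆ T ⁻¹' S.closureL2 B :=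
    closure_minimal (by rintro _ ⟨b, hb, rfl⟩; exact hT b hb)
      ((S.isClosed_closureL2 B).preimage T.continuous)
  exact this hξ

theorem lmul_mem_closureL2 {B : Subalgebra ℂ A} {a : A} (ha : a ∈ B) {ξ : S.L2}
    (hξ : ξ ∈ S.closureL2 B) : S.lmul a ξ ∈ S.closureL2 B :=
  S.map_mem_closureL2 _ (fun b hb ↦ by
    rw [lmul_toL2]; exact S.toL2_mem_closureL2 (mul_mem ha hb)) hξ

theorem rmul_mem_closureL2 {B : Subalgebra ℂ A} {a : A} (ha : a ∈ B) {ξ : S.L2}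
    (hξ : ξ ∈ S.closureL2 B) : S.rmul a ξ ∈ S.closureL2 B :=
  S.map_mem_closureL2 _ (fun b hb ↦ by
    rw [rmul_toL2]; exact S.toL2_mem_closureL2 (mul_mem hb ha)) hξ

/-- A vector of the closure of a self-adjoint algebra is determined by its pairing with it. -/
theorem eq_of_pairing_eq {B : Subalgebra ℂ A} (hB : ∀ b ∈ B, star b ∈ B) {ξ η : S.L2}
    (hξ : ξ ∈ S.closureL2 B) (hη : η ∈ S.closureL2 B)
    (h : ∀ b ∈ B, S.pairing ξ b = S.pairing η b) : ξ = η := by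
  have h1 : ∀ ζ ∈ S.closureL2 B, ⟪ζ, ξ - η⟫_ℂ = 0 := by
    have : closure (S.toL2 '' (B : Set A)) ⊆ {ζ | ⟪ζ, ξ - η⟫_ℂ = 0} :=
      closure_minimal (by
        rintro _ ⟨b, hb, rfl⟩
        have := h _ (hB b hb)
        simpa [pairing_apply, inner_sub_right, sub_eq_zero] using this)
        (isClosed_eq (by fun_prop) (by fun_prop))
    exact fun ζ hζ ↦ this hζ
  exact sub_eq_zero.1 (inner_self_eq_zero.1 (h1 _ (Submodule.sub_mem _ hξ hη)))

/-- The orthogonal projection onto the closure of a self-adjoint algebra does not change the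
pairing with this algebra. -/
theorem pairing_starProjection {B : Subalgebra ℂ A} (hB : ∀ b ∈ B, star b ∈ B) (ξ : S.L2) {b : A}
    (hb : b ∈ B) : S.pairing ((S.closureL2 B).starProjection ξ) b = S.pairing ξ b := by
  rw [pairing_apply, pairing_apply, ← Submodule.inner_starProjection_left_eq_right,
    Submodule.starProjection_eq_self_iff.2 (S.toL2_mem_closureL2 (hB b hb))]

end RectSpace

namespace RectSpace

/-! ### Words in a family of elements of corners -/

section Words

variable {R : Type*} [Ring R] {d : ℕ} {I : Type*} {P : Fin d → R} {X : I → R} {r c : I → Fin d}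

theorem p_mul_word_eq_zero (hP : ∀ i j, i ≠ j → P i * P j = 0) (hr : ∀ i, P (r i) * X i = X i)
    (hc : ∀ i, X i * P (c i) = X i) {s t : Fin d} {w : List I} (h : ¬ IsPath r c s w t) :
    P s * (w.map X).prod * P t = 0 := by
  induction w generalizing s with
  | nil => simpa using hP s t h
  | cons i w ih =>
    rw [List.map_cons, List.prod_cons]
    by_cases h1 : r i = s
    · have h2 : ¬ IsPath r c (c i) w t := fun h3 ↦ h ⟨h1, h3⟩
      rw [← hc i, mul_assoc (X i), ← mul_assoc, mul_assoc (P s * X i), ih h2, mul_zero]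
    · rw [← hr i, ← mul_assoc, ← mul_assoc, hP s (r i) (Ne.symm h1)]; simp

/-- The corner relations absorb every projection next to a letter, so the span of projections and
pure words is stable under left multiplication by generators. The ring is arbitrary because the
lemma is applied to pairs (value, triangular matrix of a derivation), not just in `A`. -/
theorem lift_mem_span_words [Algebra ℂ R] (hP : ∀ i j, P i * P j = if i = j then P i else 0)
    (hr : ∀ i, P (r i) * X i = X i) (hc : ∀ i, X i * P (c i) = X i)
    (f : FreeAlgebra ℂ (Fin d ⊕ I)) :
    FreeAlgebra.lift ℂ (Sum.elim P X) f ∈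
      Submodule.span ℂ (Set.range P ∪ Set.range fun w : List I ↦ (w.map X).prod) := by
  set V := Submodule.span ℂ (Set.range P ∪ Set.range fun w : List I ↦ (w.map X).prod) with hV
  have memP : ∀ j, P j ∈ V := fun j ↦ Submodule.subset_span (Or.inl ⟨j, rfl⟩)
  have memX : ∀ w : List I, (w.map X).prod ∈ V := fun w ↦ Submodule.subset_span (Or.inr ⟨w, rfl⟩)
  have h1 : ∀ s, ∀ m ∈ V, P s * m ∈ V := by
    intro s
    suffices V ≤ V.comap (LinearMap.mulLeft ℂ (P s)) from fun m hm ↦ this hm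
    refine Submodule.span_le.2 ?_
    rintro _ (⟨j, rfl⟩ | ⟨w, rfl⟩)
    · change P s * P j ∈ V
      rw [hP]; split_ifs
      · exact memP s
      · exact V.zero_mem
    · change P s * (w.map X).prod ∈ V
      cases w with
      | nil => simpa using memP s
      | cons i w =>
        rw [List.map_cons, List.prod_cons, ← hr i, ← mul_assoc, ← mul_assoc, hP]
        split_ifs with h
        · rw [h, hr]; exact memX (i :: w)
        · simp
  have h2 : ∀ i, ∀ m ∈ V, X i * m ∈ V := by
    intro i
    suffices V ≤ V.comap (LinearMap.mulLeft ℂ (X i)) from fun m hm ↦ this hm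
    refine Submodule.span_le.2 ?_
    rintro _ (⟨j, rfl⟩ | ⟨w, rfl⟩)
    · change X i * P j ∈ V
      rw [← hc i, mul_assoc, hP]; split_ifs
      · rw [hc]; simpa using memX [i]
      · simp
    · exact memX (i :: w)
  have h3 : ∀ f : FreeAlgebra ℂ (Fin d ⊕ I), ∀ m ∈ V,
      FreeAlgebra.lift ℂ (Sum.elim P X) f * m ∈ V := by
    intro f
    induction f using FreeAlgebra.induction with
    | grade0 t => intro m hm; simpa [Algebra.algebraMap_eq_smul_one] using V.smul_mem t hm
    | grade1 s =>
      intro m hm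
      cases s with
      | inl j => simpa using h1 j m hm
      | inr i => simpa using h2 i m hm
    | mul f g hf hg => intro m hm; rw [map_mul, mul_assoc]; exact hf _ (hg _ hm)
    | add f g hf hg => intro m hm; rw [map_add, add_mul]; exact V.add_mem (hf _ hm) (hg _ hm)
  simpa using h3 f 1 (by simpa using memX [])

end Words

/-! ### Derivations of free algebras with values in `A ⊗ A` -/

section Derivations

variable {A : Type*} [Ring A] [Algebra ℂ A] {X : Type*} (v : X → A) (g : X → A ⊗[ℂ] A)

/-- The representation of the free algebra by triangular matrices whose off-diagonal entry is the
derivation with values `g` on the generators. -/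
def derivMat : FreeAlgebra ℂ X →ₐ[ℂ] Matrix (Fin 2) (Fin 2) (A ⊗[ℂ] A) :=
  FreeAlgebra.lift ℂ fun s ↦ !![v s ⊗ₜ[ℂ] 1, g s; 0, 1 ⊗ₜ[ℂ] v s]

/-- With these entries known, the Leibniz rule `deriv_mul` is just the (0, 1) entry of a matrix
product. -/
theorem derivMat_diag (f : FreeAlgebra ℂ X) :
    derivMat v g f 0 0 = FreeAlgebra.lift ℂ v f ⊗ₜ[ℂ] 1 ∧ derivMat v g f 1 0 = 0 ∧
      derivMat v g f 1 1 = 1 ⊗ₜ[ℂ] FreeAlgebra.lift ℂ v f := by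
  induction f using FreeAlgebra.induction with
  | grade0 t =>
    simp [Algebra.algebraMap_eq_smul_one, TensorProduct.smul_tmul', Algebra.TensorProduct.one_def]
  | grade1 s => simp [derivMat]
  | mul f g hf hg =>
    obtain ⟨h1, h2, h3⟩ := hf
    obtain ⟨h4, h5, h6⟩ := hg
    simp [Matrix.mul_apply, Fin.sum_univ_two, h1, h2, h3, h4, h5, h6]
  | add f g hf hg =>
    obtain ⟨h1, h2, h3⟩ := hf
    obtain ⟨h4, h5, h6⟩ := hg
    simp [h1, h2, h3, h4, h5, h6, TensorProduct.add_tmul, TensorProduct.tmul_add]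

/-- The derivation over `f ↦ f (v)` with values `g` on the generators. -/
def deriv : FreeAlgebra ℂ X →ₗ[ℂ] A ⊗[ℂ] A where
  toFun f := derivMat v g f 0 1
  map_add' := by simp
  map_smul' := by simp

theorem deriv_mul (f h : FreeAlgebra ℂ X) :
    deriv v g (f * h) = (FreeAlgebra.lift ℂ v f ⊗ₜ[ℂ] 1) * deriv v g h +
      deriv v g f * (1 ⊗ₜ[ℂ] FreeAlgebra.lift ℂ v h) := by
  change derivMat v g (f * h) 0 1 = _ * derivMat v g h 0 1 + derivMat v g f 0 1 * _
  simp [Matrix.mul_apply, Fin.sum_univ_two, derivMat_diag v g f, derivMat_diag v g h]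

@[simp] theorem deriv_ι (s : X) : deriv v g (FreeAlgebra.ι ℂ s) = g s := by
  simp [deriv, derivMat]

@[simp] theorem deriv_one : deriv v g 1 = 0 := by
  simp [deriv]

theorem deriv_map {Y : Type*} (m : Y → X) (f : FreeAlgebra ℂ Y) :
    deriv v g (FreeAlgebra.lift ℂ (FreeAlgebra.ι ℂ ∘ m) f) = deriv (v ∘ m) (g ∘ m) f := by
  have : (derivMat v g).comp (FreeAlgebra.lift ℂ (FreeAlgebra.ι ℂ ∘ m)) =
      derivMat (v ∘ m) (g ∘ m) := by
    ext1; funext s; simp [derivMat]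
  exact congrArg (fun M ↦ M 0 1) (DFunLike.congr_fun this f)

/-- The linear map `u ⊗ v ↦ u x ⊗ y v`. -/
def inner (x y : A) : A ⊗[ℂ] A →ₗ[ℂ] A ⊗[ℂ] A :=
  TensorProduct.map (LinearMap.mulRight ℂ x) (LinearMap.mulLeft ℂ y)

@[simp] theorem inner_tmul (x y u v : A) : inner x y (u ⊗ₜ v) = (u * x) ⊗ₜ (y * v) := rfl

theorem inner_tmul_mul (x y u : A) (T : A ⊗[ℂ] A) :
    inner x y ((u ⊗ₜ 1) * T) = (u ⊗ₜ 1) * inner x y T := by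
  induction T with
  | zero => simp
  | tmul a b => simp [mul_assoc]
  | add T T' h h' => simp only [mul_add, map_add, h, h']

theorem inner_mul_tmul (x y v : A) (T : A ⊗[ℂ] A) :
    inner x y (T * (1 ⊗ₜ v)) = inner x y T * (1 ⊗ₜ v) := by
  induction T with
  | zero => simp
  | tmul a b => simp [mul_assoc]
  | add T T' h h' => simp only [add_mul, map_add, h, h']

end Derivations

variable {A : Type*} [CStarAlgebra A] [PartialOrder A] [StarOrderedRing A] {d : ℕ}
  (S : RectSpace A d)

/-! ### The conjugate relations on the free algebra -/

/-- The functional `φ`, as a linear map. -/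
def trace : A →ₗ[ℂ] ℂ := S.φ.toLinearMap

@[simp] theorem trace_apply (a : A) : S.trace a = S.φ a := rfl

/-- The functional `φ ⊗ φ`. -/
def trace₂ : A ⊗[ℂ] A →ₗ[ℂ] ℂ := LinearMap.mul' ℂ ℂ ∘ₗ TensorProduct.map S.trace S.trace

@[simp] theorem trace₂_tmul (a b : A) : S.trace₂ (a ⊗ₜ b) = S.φ a * S.φ b := rfl

/-- Traciality in each leg moves a factor from the inside of the tensor to the outside. -/
theorem trace₂_inner (x y : A) (T : A ⊗[ℂ] A) :
    S.trace₂ (inner x y T) = S.trace₂ ((x ⊗ₜ 1) * T * (1 ⊗ₜ y)) := by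
  induction T with
  | zero => simp
  | tmul a b => simp [S.tracial a x, S.tracial y b]
  | add T T' h h' => simp only [add_mul, mul_add, map_add, h, h']

section FreeAlgebra

variable {I : Type*} (a : I → A) (r c : I → Fin d)

/-- The evaluation of polynomials in letters for the projections `p j` and the elements `a i`. -/
def eval : FreeAlgebra ℂ (Fin d ⊕ I) →ₐ[ℂ] A := FreeAlgebra.lift ℂ (Sum.elim S.p a)

@[simp] theorem eval_inl (j : Fin d) : S.eval a (FreeAlgebra.ι ℂ (Sum.inl j)) = S.p j := by
  simp [eval]

@[simp] theorem eval_inr (i : I) : S.eval a (FreeAlgebra.ι ℂ (Sum.inr i)) = a i := by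
  simp [eval]

/-- The monomial of a word. -/
def mono (w : List I) : FreeAlgebra ℂ (Fin d ⊕ I) :=
  (w.map fun i ↦ FreeAlgebra.ι ℂ (Sum.inr i)).prod

theorem eval_mono (w : List I) : S.eval a (mono w) = (w.map a).prod := by
  rw [mono, map_list_prod, List.map_map]
  congr 2
  funext i; simp

variable [DecidableEq I]

/-- The values on the letters of the partial free difference quotient with respect to `a i`. -/
def diffGen (i : I) : Fin d ⊕ I → A ⊗[ℂ] A :=
  Sum.elim 0 fun j ↦ if i = j then S.p (r i) ⊗ₜ S.p (c i) else 0

/-- The partial free difference quotient with respect to `a i`. -/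
def diff (i : I) : FreeAlgebra ℂ (Fin d ⊕ I) →ₗ[ℂ] A ⊗[ℂ] A :=
  deriv (Sum.elim S.p a) (S.diffGen r c i)

theorem diff_mul (i : I) (f g : FreeAlgebra ℂ (Fin d ⊕ I)) :
    S.diff a r c i (f * g) = (S.eval a f ⊗ₜ 1) * S.diff a r c i g +
      S.diff a r c i f * (1 ⊗ₜ S.eval a g) := deriv_mul _ _ f g

@[simp] theorem diff_inl (i : I) (j : Fin d) :
    S.diff a r c i (FreeAlgebra.ι ℂ (Sum.inl j)) = 0 := by simp [diff, diffGen]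

@[simp] theorem diff_inr (i j : I) : S.diff a r c i (FreeAlgebra.ι ℂ (Sum.inr j)) =
    if i = j then S.p (r i) ⊗ₜ S.p (c i) else 0 := by simp [diff, diffGen]

@[simp] theorem diff_one (i : I) : S.diff a r c i 1 = 0 := deriv_one _ _

theorem diff_mono (i : I) (w : List I) : S.diff a r c i (mono w) =
    ∑ m : Fin w.length, if i = w.get m then
      (((w.take m).map a).prod * S.p (r i)) ⊗ₜ (S.p (c i) * ((w.drop (m + 1)).map a).prod)
      else 0 := by
  induction w with
  | nil => simp [mono]
  | cons j w ih =>
    have : (mono (j :: w) : FreeAlgebra ℂ (Fin d ⊕ I)) =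
      FreeAlgebra.ι ℂ (Sum.inr j) * mono w := by simp [mono]
    rw [this, diff_mul, ih, add_comm]
    refine Eq.trans ?_ (Fin.sum_univ_succ (n := w.length) _).symm
    congr 1
    · simp [eval_mono, ite_mul]
    · rw [Finset.mul_sum]
      refine Finset.sum_congr rfl fun m _ ↦ ?_
      simp only [List.get_cons_succ', Fin.val_succ, List.take_succ_cons, List.drop_succ_cons,
        List.map_cons, List.prod_cons, eval_inr, mul_ite, mul_zero]
      simp [mul_assoc]

theorem inner_diff (i : I) (f : FreeAlgebra ℂ (Fin d ⊕ I)) :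
    inner (S.p (r i)) (S.p (c i)) (S.diff a r c i f) = S.diff a r c i f := by
  induction f using FreeAlgebra.induction with
  | grade0 t => simp [Algebra.algebraMap_eq_smul_one]
  | grade1 s =>
    cases s with
    | inl j => simp
    | inr j => rw [diff_inr]; split_ifs <;> simp
  | mul f g hf hg => rw [diff_mul, map_add, inner_tmul_mul, inner_mul_tmul, hf, hg]
  | add f g hf hg => rw [map_add, map_add, hf, hg]

/-- The conjugate relation of index `i`, for the polynomial `f`. -/
def ConjRel (ξ : I → S.L2) (i : I) (f : FreeAlgebra ℂ (Fin d ⊕ I)) : Prop :=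
  S.φ (S.p (r i)) * S.pairing (ξ i) (S.eval a f) = S.trace₂ (S.diff a r c i f)

variable {a r c}

/-- Both sides differ from their normalized versions by the common nonzero factor `φ (p (r i)) * φ
(p (c i))`. -/
theorem conjRel_mono_iff {ξ : I → S.L2} {i : I} (hξ : ξ i ∈ S.cornerL2 (c i) (r i)) (w : List I) :
    S.ConjRel a r c ξ i (mono w) ↔ S.phiL2 (c i) (S.rmul (w.map a).prod (ξ i)) =
        ∑ m : Fin w.length, if i = w.get m then
          S.phi (r i) ((w.take m).map a).prod * S.phi (c i) ((w.drop (m + 1)).map a).prod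
        else 0 := by
  have h1 : S.pairing (ξ i) (w.map a).prod =
      S.φ (S.p (c i)) * S.phiL2 (c i) (S.rmul (w.map a).prod (ξ i)) := by
    rw [phiL2_rmul, S.pairing_cornerL2 hξ (w.map a).prod,
      S.pairing_cornerL2 hξ ((w.map a).prod * S.p (c i))]
    simp [mul_assoc]
  have h2 : S.trace₂ (S.diff a r c i (mono w)) = S.φ (S.p (r i)) * (S.φ (S.p (c i)) *
      ∑ m : Fin w.length, if i = w.get m then
          S.phi (r i) ((w.take m).map a).prod * S.phi (c i) ((w.drop (m + 1)).map a).prod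
        else 0) := by
    rw [diff_mono, map_sum, Finset.mul_sum, Finset.mul_sum]
    refine Finset.sum_congr rfl fun m _ ↦ ?_
    split_ifs
    · rw [trace₂_tmul, ← phi_mul, S.tracial _ (S.p (r i)), ← phi_mul]; ring
    · simp
  rw [ConjRel, eval_mono, h1, h2, mul_right_inj' (S.φ_p_ne_zero _),
    mul_right_inj' (S.φ_p_ne_zero _)]

/-- The defect of the relation depends on f only through its value and its derivation matrix, which
together form one homomorphism into a ring where the generators still satisfy the corner relations.
By `lift_mem_span_words` it suffices to treat projections and words. The defect does not change
under compression by `P (r i)` and `P (c i)`, and this compression kills the words that are not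
paths. -/
theorem conjRel_of_words {ξ : I → S.L2} (ha : ∀ i, a i ∈ S.corner (r i) (c i)) {i : I}
    (hξ : ξ i ∈ S.cornerL2 (c i) (r i))
    (h : ∀ w : List I, IsPath r c (r i) w (c i) → S.ConjRel a r c ξ i (mono w))
    (f : FreeAlgebra ℂ (Fin d ⊕ I)) : S.ConjRel a r c ξ i f := by
  let P : Fin d → A × Matrix (Fin 2) (Fin 2) (A ⊗[ℂ] A) := fun j ↦
    (S.p j, !![S.p j ⊗ₜ[ℂ] 1, 0; 0, 1 ⊗ₜ[ℂ] S.p j])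
  let X : I → A × Matrix (Fin 2) (Fin 2) (A ⊗[ℂ] A) := fun j ↦
    (a j, !![a j ⊗ₜ[ℂ] 1, if i = j then S.p (r i) ⊗ₜ S.p (c i) else 0; 0, 1 ⊗ₜ[ℂ] a j])
  have hlift : ∀ f, FreeAlgebra.lift ℂ (Sum.elim P X) f = (S.eval a f,
      derivMat (Sum.elim S.p a) (S.diffGen r c i) f) := by
    have : FreeAlgebra.lift ℂ (Sum.elim P X) = (S.eval a).prod
        (derivMat (Sum.elim S.p a) (S.diffGen r c i)) := by
      ext1; funext s
      cases s <;> simp [P, X, eval, derivMat, diffGen]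
    intro f; rw [this]; rfl
  have h0 : (!![0, 0; 0, 0] : Matrix (Fin 2) (Fin 2) (A ⊗[ℂ] A)) = 0 := by
    ext i j; fin_cases i <;> fin_cases j <;> rfl
  have hP : ∀ i j, P i * P j = if i = j then P i else 0 := by
    intro i j
    split_ifs with hij
    · subst hij; simp [P]
    · simp [P, S.orthogonal i j hij, h0]
  have hr : ∀ j, P (r j) * X j = X j := by
    intro j
    have := S.p_mul_of_mem_corner (ha j)
    simp only [P, X, Prod.mk_mul_mk, this, Matrix.mul_fin_two]
    split_ifs with hij
    · subst hij; simp [this]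
    · simp [this]
  have hc : ∀ j, X j * P (c j) = X j := by
    intro j
    have := S.mul_p_of_mem_corner (ha j)
    simp only [P, X, Prod.mk_mul_mk, this, Matrix.mul_fin_two]
    split_ifs with hij
    · subst hij; simp [this]
    · simp [this]
  let θ : A × Matrix (Fin 2) (Fin 2) (A ⊗[ℂ] A) →ₗ[ℂ] ℂ :=
    S.φ (S.p (r i)) • S.pairing (ξ i) ∘ₗ LinearMap.fst ℂ _ _ -
      S.trace₂ ∘ₗ Matrix.entryLinearMap ℂ _ 0 1 ∘ₗ LinearMap.snd ℂ _ _
  have hθ : ∀ f, S.ConjRel a r c ξ i f ↔ θ (FreeAlgebra.lift ℂ (Sum.elim P X) f) = 0 := by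
    intro f
    rw [hlift, ConjRel, ← sub_eq_zero]
    rfl
  -- The pairing is invariant since `ξ i` lies in a corner; the tensor side is invariant since ∂_i
  -- takes values in A p_{r(i)} ⊗ p_{c(i)} A (`inner_diff`).
  have hθc : ∀ f, θ (P (r i) * FreeAlgebra.lift ℂ (Sum.elim P X) f * P (c i)) =
      θ (FreeAlgebra.lift ℂ (Sum.elim P X) f) := by
    intro f
    have h1 : θ (FreeAlgebra.lift ℂ (Sum.elim P X) f) = S.φ (S.p (r i)) *
      S.pairing (ξ i) (S.eval a f) - S.trace₂ (S.diff a r c i f) := by rw [hlift]; rfl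
    have h2 : P (r i) * FreeAlgebra.lift ℂ (Sum.elim P X) f * P (c i) =
        FreeAlgebra.lift ℂ (Sum.elim P X) (FreeAlgebra.ι ℂ (Sum.inl (r i)) * f *
          FreeAlgebra.ι ℂ (Sum.inl (c i))) := by simp
    have h3 : ∀ f, θ (FreeAlgebra.lift ℂ (Sum.elim P X) f) = S.φ (S.p (r i)) *
      S.pairing (ξ i) (S.eval a f) - S.trace₂ (S.diff a r c i f) := by
      intro f; rw [hlift]; rfl
    rw [h2, h3, h3, S.pairing_cornerL2 hξ (S.eval a f), ← S.inner_diff a r c i f, trace₂_inner]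
    simp [diff_mul]
  have hword : ∀ w : List I, (w.map X).prod = FreeAlgebra.lift ℂ (Sum.elim P X) (mono w) := by
    intro w
    rw [mono, map_list_prod, List.map_map]
    congr 2
    funext i; simp
  have hw : ∀ w : List I, θ (w.map X).prod = 0 := by
    intro w
    by_cases hp : IsPath r c (r i) w (c i)
    · rw [hword]; exact (hθ _).1 (h w hp)
    · rw [hword, ← hθc, ← hword, p_mul_word_eq_zero (fun i j hij ↦ by rw [hP, if_neg hij]) hr hc hp,
        map_zero]
  have hPj : ∀ j, θ (P j) = 0 := by
    intro j
    have h1 : P j = FreeAlgebra.lift ℂ (Sum.elim P X) (FreeAlgebra.ι ℂ (Sum.inl j)) := by simp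
    -- The compression of `P j` is zero unless r(i) = j = c(i), and then it is the compression of 1,
    -- the empty word.
    rw [h1, ← hθc, ← h1, hP]
    split_ifs with h2
    · rw [hP]
      split_ifs with h3
      · have h4 := hθc 1
        rw [_root_.map_one, mul_one, hP, if_pos h3] at h4
        rw [h4]; simpa using hw []
      · simp
    · simp
  rw [hθ]
  have : Submodule.span ℂ (Set.range P ∪ Set.range fun w : List I ↦ (w.map X).prod) ≤ θ.ker := by
    refine Submodule.span_le.2 ?_
    rintro _ (⟨j, rfl⟩ | ⟨w, rfl⟩)
    · exact hPj j
    · exact hw w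
  exact this (lift_mem_span_words hP hr hc f)

theorem conjugateRelations_iff {ξ : I → S.L2} :
    S.ConjugateRelations a ξ ↔ ∃ r c : I → Fin d, (∀ i, a i ≠ 0 ∧ a i ∈ S.corner (r i) (c i)) ∧
      (∀ i, ξ i ∈ S.cornerL2 (c i) (r i)) ∧ ∀ i f, S.ConjRel a r c ξ i f := by
  constructor
  · rintro ⟨r, c, h1, h2, h3⟩
    exact ⟨r, c, h1, fun i ↦ (h2 i).2, fun i ↦ S.conjRel_of_words (fun j ↦ (h1 j).2) (h2 i).2
      fun w hw ↦ (S.conjRel_mono_iff (h2 i).2 w).2 (h3 i w hw)⟩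
  · rintro ⟨r, c, h1, h2, h3⟩
    refine ⟨r, c, h1, fun i ↦ ⟨fun h0 ↦ ?_, h2 i⟩,
      fun i w _ ↦ (S.conjRel_mono_iff (h2 i) w).1 (h3 i _)⟩
    -- Nonvanishing of `ξ i` is automatic: on the single letter a_i the tensor side is `φ (p (r i))
    -- * φ (p (c i))`, which is not 0.
    have := h3 i (FreeAlgebra.ι ℂ (Sum.inr i))
    rw [ConjRel, h0] at this
    simp [pairing_apply, φ_p_ne_zero] at this

end FreeAlgebra

end RectSpace

namespace RectSpace

variable {A : Type*} [CStarAlgebra A] [PartialOrder A] [StarOrderedRing A] {d : ℕ}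
  (S : RectSpace A d)

/-! ### Uniqueness and restriction of conjugate systems -/

section Restriction

variable {I J : Type*} (a : I → A)

/-- The algebra generated by a family and `𝒟`. -/
def alg : Subalgebra ℂ A := Algebra.adjoin ℂ (Set.range a ∪ (S.D : Set A))

variable {a}

theorem mem_alg (i : I) : a i ∈ S.alg a := Algebra.subset_adjoin (Or.inl ⟨i, rfl⟩)

theorem p_mem_alg (j : Fin d) : S.p j ∈ S.alg a := Algebra.subset_adjoin (Or.inr (S.p_mem_D j))

theorem range_eval : (S.eval a).range = S.alg a := by
  apply le_antisymm
  · rintro _ ⟨f, rfl⟩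
    change S.eval a f ∈ _
    induction f using FreeAlgebra.induction with
    | grade0 t => rw [AlgHom.commutes]; exact Subalgebra.algebraMap_mem _ t
    | grade1 s =>
      cases s with
      | inl j => simpa using S.p_mem_alg j
      | inr i => simpa using S.mem_alg i
    | mul f g hf hg => rw [map_mul]; exact mul_mem hf hg
    | add f g hf hg => rw [map_add]; exact add_mem hf hg
  · refine Algebra.adjoin_le (Set.union_subset ?_ ?_)
    · rintro _ ⟨i, rfl⟩; exact ⟨FreeAlgebra.ι ℂ (Sum.inr i), S.eval_inr a i⟩
    · have : S.D ≤ (S.eval a).range.toSubmodule := by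
        refine Submodule.span_le.2 ?_
        rintro _ ⟨j, rfl⟩; exact ⟨FreeAlgebra.ι ℂ (Sum.inl j), S.eval_inl a j⟩
      exact this

theorem eval_mem_alg (f : FreeAlgebra ℂ (Fin d ⊕ I)) : S.eval a f ∈ S.alg a := by
  rw [← range_eval]; exact ⟨f, rfl⟩

theorem star_mem_alg (ha : ∀ i, star (a i) ∈ Set.range a) {b : A} (hb : b ∈ S.alg a) :
    star b ∈ S.alg a := by
  induction hb using Algebra.adjoin_induction with
  | mem x hx =>
    rcases hx with ⟨i, rfl⟩ | hx
    · exact Algebra.subset_adjoin (Or.inl (ha i))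
    · induction hx using Submodule.span_induction with
      | mem x hx => obtain ⟨j, rfl⟩ := hx; simpa using S.p_mem_alg j
      | zero => simp
      | add x y _ _ hx hy => rw [star_add]; exact add_mem hx hy
      | smul t x _ hx => rw [star_smul]; exact Subalgebra.smul_mem _ hx _
  | algebraMap t => rw [← algebraMap_star_comm]; exact Subalgebra.algebraMap_mem _ _
  | add x y _ _ hx hy => rw [star_add]; exact add_mem hx hy
  | mul x y _ _ hx hy => rw [star_mul]; exact mul_mem hy hx

theorem alg_comp_le (ι : J → I) : S.alg (a ∘ ι) ≤ S.alg a :=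
  Algebra.adjoin_mono (Set.union_subset_union_left _ (Set.range_comp_subset_range _ _))

variable [DecidableEq I] [DecidableEq J]

/-- The relations prescribe the pairing with every element of the generated algebra, which is
self-adjoint and dense in the closure containing both vectors. -/
theorem IsConjugateSystem.unique {S : RectSpace A d} (ha : ∀ i, star (a i) ∈ Set.range a)
    {ξ η : I → S.L2}
    (hξ : S.IsConjugateSystem a ξ) (hη : S.IsConjugateSystem a η) : ξ = η := by
  obtain ⟨r, c, h1, h2, h3⟩ := S.conjugateRelations_iff.1 hξ.1
  obtain ⟨r', c', h1', h2', h3'⟩ := S.conjugateRelations_iff.1 hη.1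
  have hr : r' = r := funext fun i ↦ (S.corner_unique (h1' i).1 (h1' i).2 (h1 i).2).1
  have hc : c' = c := funext fun i ↦ (S.corner_unique (h1' i).1 (h1' i).2 (h1 i).2).2
  subst hr hc
  funext i
  refine S.eq_of_pairing_eq (fun b hb ↦ S.star_mem_alg ha hb) (hξ.2 i) (hη.2 i) fun b hb ↦ ?_
  rw [← SetLike.mem_coe, SetLike.mem_coe, ← range_eval] at hb
  obtain ⟨f, rfl⟩ := hb
  exact mul_left_cancel₀ (S.φ_p_ne_zero _) ((h3 i f).trans (h3' i f).symm)

theorem IsConjugateSystem.fisher_eq {S : RectSpace A d} (ha : ∀ i, star (a i) ∈ Set.range a)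
    {ξ : I → S.L2}
    (hξ : S.IsConjugateSystem a ξ) : S.fisher a = ∑' i, ENNReal.ofReal (‖ξ i‖ ^ 2) := by
  have h : ∃ ξ : I → S.L2, S.IsConjugateSystem a ξ := ⟨ξ, hξ⟩
  rw [fisher, dif_pos h, h.choose_spec.unique ha hξ]

theorem exists_isConjugateSystem_of_fisher_ne_top (h : S.fisher a ≠ ∞) :
    ∃ ξ : I → S.L2, S.IsConjugateSystem a ξ := by
  by_contra hn
  exact h (by rw [fisher, dif_neg hn])

/-- The homomorphism of free algebras given by a map of the indices. -/
def relabel (ι : J → I) : FreeAlgebra ℂ (Fin d ⊕ J) →ₐ[ℂ] FreeAlgebra ℂ (Fin d ⊕ I) :=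
  FreeAlgebra.lift ℂ (FreeAlgebra.ι ℂ ∘ Sum.map id ι)

omit [DecidableEq I] [DecidableEq J] in
theorem eval_relabel (ι : J → I) (f : FreeAlgebra ℂ (Fin d ⊕ J)) :
    S.eval a (relabel ι f) = S.eval (a ∘ ι) f := by
  have : (S.eval a).comp (relabel ι) = S.eval (a ∘ ι) := by
    ext1; funext s
    cases s <;> simp [relabel, eval]
  exact DFunLike.congr_fun this f

theorem diff_relabel {ι : J → I} (hι : Function.Injective ι) (r c : I → Fin d) (j : J)
    (f : FreeAlgebra ℂ (Fin d ⊕ J)) : S.diff a r c (ι j) (relabel ι f) =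
      S.diff (a ∘ ι) (r ∘ ι) (c ∘ ι) j f := by
  rw [diff, relabel, deriv_map, diff, Sum.elim_comp_map]
  congr 1
  congr 1
  funext s
  cases s <;> simp [diffGen, hι.eq_iff]

theorem conjRel_relabel_iff {ι : J → I} (hι : Function.Injective ι) {r c : I → Fin d}
    (ξ : I → S.L2) (j : J) (f : FreeAlgebra ℂ (Fin d ⊕ J)) :
    S.ConjRel a r c ξ (ι j) (relabel ι f) ↔
      S.ConjRel (a ∘ ι) (r ∘ ι) (c ∘ ι) (ξ ∘ ι) j f := by
  rw [ConjRel, ConjRel, eval_relabel, S.diff_relabel hι]; rfl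

/-- The projections of a conjugate system onto the closure of the algebra of a subfamily form a
conjugate system of this subfamily. -/
theorem IsConjugateSystem.restrict {S : RectSpace A d} {ι : J → I} (hι : Function.Injective ι)
    (ha : ∀ j, star ((a ∘ ι) j) ∈ Set.range (a ∘ ι)) {ξ : I → S.L2}
    (hξ : S.IsConjugateSystem a ξ) : S.IsConjugateSystem (a ∘ ι) fun j ↦
      (S.closureL2 (S.alg (a ∘ ι))).starProjection (ξ (ι j)) := by
  obtain ⟨r, c, h1, h2, h3⟩ := S.conjugateRelations_iff.1 hξ.1
  have hs : ∀ b ∈ S.alg (a ∘ ι), star b ∈ S.alg (a ∘ ι) := fun b hb ↦ S.star_mem_alg ha hb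
  have hmem : ∀ j, (S.closureL2 (S.alg (a ∘ ι))).starProjection (ξ (ι j)) ∈
      S.closureL2 (S.alg (a ∘ ι)) := fun j ↦ Submodule.starProjection_apply_mem _ _
  refine ⟨S.conjugateRelations_iff.2 ⟨r ∘ ι, c ∘ ι, fun j ↦ h1 (ι j), fun j ↦ ?_, fun j f ↦ ?_⟩,
    hmem⟩
  -- The projections p_t belong to the algebra, so compressing to a corner commutes with projecting
  -- onto its closure; this is tested by pairing.
  · refine S.eq_of_pairing_eq hs (S.lmul_mem_closureL2 (S.p_mem_alg _)
      (S.rmul_mem_closureL2 (S.p_mem_alg _) (hmem j))) (hmem j) fun b hb ↦ ?_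
    rw [pairing_lmul, pairing_rmul, S.pairing_starProjection hs _ hb, S.pairing_starProjection hs,
      S.pairing_cornerL2 (h2 (ι j)) b, mul_assoc]; rfl
    exact mul_mem (S.p_mem_alg _) (mul_mem hb (S.p_mem_alg _))
  · have := (S.conjRel_relabel_iff hι ξ j f).1 (h3 (ι j) _)
    rw [ConjRel] at this ⊢
    rw [← this, S.pairing_starProjection hs _ (S.eval_mem_alg f)]; rfl

end Restriction

end RectSpace

namespace RectSpace

/-! ### Alternating products -/

/-- `Alt Z n i k u`: `u` is an alternating product of `n + 1` factors from the sets `Z j`, the first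
factor being in `Z i` and the last one in `Z k`. -/
inductive Alt {M J : Type*} [Mul M] (Z : J → Set M) : ℕ → J → J → M → Prop
  | single {j : J} {z : M} : z ∈ Z j → Alt Z 0 j j z
  | cons {n : ℕ} {i j k : J} {z w : M} : z ∈ Z i → i ≠ j → Alt Z n j k w →
      Alt Z (n + 1) i k (z * w)

section Alt

variable {M J : Type*} [Monoid M] {Z : J → Set M}

theorem Alt.snoc {n : ℕ} {i j k : J} {u z : M} (h : Alt Z n i j u) (hz : z ∈ Z k) (hjk : j ≠ k) :
    Alt Z (n + 1) i k (u * z) := by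
  induction h with
  | single hu => exact .cons hu hjk (.single hz)
  | cons hu hij _ ih => rw [mul_assoc]; exact .cons hu hij (ih hjk)

theorem Alt.exists_snoc {n : ℕ} {i k : J} {u : M} (h : Alt Z (n + 1) i k u) :
    ∃ j v z, Alt Z n i j v ∧ z ∈ Z k ∧ j ≠ k ∧ u = v * z := by
  generalize hm : n + 1 = m at h
  induction h generalizing n with
  | single _ => omega
  | @cons m i j k y w hy hij hw ih =>
    obtain rfl : n = m := by omega
    cases n with
    | zero => cases hw with
      | single hw => exact ⟨i, y, w, .single hy, hw, hij, rfl⟩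
    | succ n =>
      obtain ⟨l, v, z, h1, h2, h3, rfl⟩ := ih rfl
      exact ⟨l, y * v, z, .cons hy hij h1, h2, h3, by rw [mul_assoc]⟩

theorem Alt.map {N : Type*} [Monoid N] {Y : J → Set N} (F : M →* N)
    (hF : ∀ j, ∀ z ∈ Z j, F z ∈ Y j) {n : ℕ} {i k : J} {u : M} (h : Alt Z n i k u) :
    Alt Y n i k (F u) := by
  induction h with
  | single hu => exact .single (hF _ _ hu)
  | cons hu hij _ ih => rw [map_mul]; exact .cons (hF _ _ hu) hij ih

theorem Alt.mul_left {e : M} (he : ∀ j, ∀ z ∈ Z j, e * z ∈ Z j) {n : ℕ} {i k : J} {u : M}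
    (h : Alt Z n i k u) : Alt Z n i k (e * u) := by
  cases h with
  | single hu => exact .single (he _ _ hu)
  | cons hu hij hw => rw [← mul_assoc]; exact .cons (he _ _ hu) hij hw

theorem Alt.exists_ofFn {n : ℕ} {i k : J} {u : M} (h : Alt Z n i k u) :
    ∃ (j : Fin (n + 1) → J) (z : Fin (n + 1) → M), j 0 = i ∧
      (∀ t : Fin n, j t.castSucc ≠ j t.succ) ∧ (∀ t, z t ∈ Z (j t)) ∧ u = (List.ofFn z).prod := by
  induction h with
  | @single j z hz => exact ⟨fun _ ↦ j, fun _ ↦ z, rfl, nofun, fun _ ↦ hz, by simp⟩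
  | @cons n i j k z w hz hij _ ih =>
    obtain ⟨s, y, h0, h1, h2, rfl⟩ := ih
    refine ⟨Fin.cons i s, Fin.cons z y, rfl, fun t ↦ ?_, fun t ↦ ?_, by simp [List.ofFn_succ]⟩
    · cases t using Fin.cases with
      | zero => simpa [h0] using hij
      | succ t => simpa [← Fin.succ_castSucc] using h1 t
    · cases t using Fin.cases with
      | zero => simpa using hz
      | succ t => simpa using h2 t

theorem Alt.of_ofFn {n : ℕ} {j : Fin (n + 1) → J} {z : Fin (n + 1) → M}
    (hj : ∀ t : Fin n, j t.castSucc ≠ j t.succ) (hz : ∀ t, z t ∈ Z (j t)) :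
    Alt Z n (j 0) (j (Fin.last n)) (List.ofFn z).prod := by
  induction n with
  | zero => simpa using Alt.single (hz 0)
  | succ n ih =>
    rw [List.ofFn_succ, List.prod_cons]
    exact .cons (hz 0) (hj 0) (ih (j := fun t ↦ j t.succ) (z := fun t ↦ z t.succ)
      (fun t ↦ hj t.succ) fun t ↦ hz t.succ)

end Alt

variable {A : Type*} [CStarAlgebra A] [PartialOrder A] [StarOrderedRing A] {d : ℕ}
  (S : RectSpace A d)

section Freeness

variable {J : Type*} {B : J → Subalgebra ℂ A}

/-- The centered elements of the algebras of a family. -/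
def centered (B : J → Subalgebra ℂ A) (j : J) : Set A := {z | z ∈ B j ∧ S.E z = 0}

/-- Trades products indexed by `Fin (n + 1)` for the inductive predicate `Alt`, on which the later
inductions run. -/
theorem freeSubalgebras_iff : S.FreeSubalgebras B ↔ (∀ j, (S.D : Set A) ⊆ B j) ∧
    ∀ n i k u, Alt (S.centered B) n i k u → S.E u = 0 := by
  refine and_congr_right fun _ ↦ ⟨fun h n i k u hu ↦ ?_, fun h n j z hj hz hE ↦ ?_⟩
  · obtain ⟨j, z, -, h1, h2, rfl⟩ := hu.exists_ofFn
    exact h n j z h1 (fun t ↦ (h2 t).1) fun t ↦ (h2 t).2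
  · exact h _ _ _ _ (Alt.of_ofFn hj fun t ↦ ⟨hz t, hE t⟩)

variable {S} (hD : ∀ j, (S.D : Set A) ⊆ B j)

include hD

theorem mul_mem_centered {j : J} {e z : A} (he : e ∈ S.D) (hz : z ∈ S.centered B j) :
    e * z ∈ S.centered B j :=
  ⟨mul_mem (hD j he) hz.1, S.E_mul_of_mem_D_left he hz.2⟩

theorem sub_E_mem_centered {j : J} {b : A} (hb : b ∈ B j) : b - S.E b ∈ S.centered B j :=
  ⟨sub_mem hb (hD j (S.E_mem_D b)), S.E_sub_E b⟩

/-- The first factor need not be centered: its part in 𝒟 is absorbed by the next factor, which stays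
centered. The hypothesis is bounded in length so that the lemma can be used inside an induction that
proves freeness. -/
theorem E_mul_alt {n : ℕ} (h : ∀ m ≤ n + 1, ∀ i k u, Alt (S.centered B) m i k u → S.E u = 0)
    {i j k : J} {b u : A} (hb : b ∈ B j) (hji : j ≠ i) (hu : Alt (S.centered B) n i k u) :
    S.E (b * u) = 0 := by
  have h1 := h _ le_rfl _ _ _ (.cons (sub_E_mem_centered hD hb) hji hu)
  have h2 := h _ (Nat.le_succ n) _ _ _
    (hu.mul_left (e := S.E b) fun j z hz ↦ mul_mem_centered hD (S.E_mem_D b) hz)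
  rw [← sub_add_cancel b (S.E b), add_mul]
  exact S.E_add _ _ h1 h2

end Freeness

end RectSpace

namespace RectSpace

variable {A : Type*} [CStarAlgebra A] [PartialOrder A] [StarOrderedRing A] {d : ℕ}
  (S : RectSpace A d)

/-! ### Polynomials in the letters of one colour -/

section Colour

variable {I J : Type*} (a : I → A) (κ : I → J)

/-- The algebra of polynomials in the letters for the projections and the letters of a colour. -/
def colourAlg (d : ℕ) (j : J) : Subalgebra ℂ (FreeAlgebra ℂ (Fin d ⊕ I)) :=
  Algebra.adjoin ℂ (Set.range (fun s ↦ FreeAlgebra.ι ℂ (Sum.inl s)) ∪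
    (fun i ↦ FreeAlgebra.ι ℂ (Sum.inr i)) '' {i | κ i = j})

theorem inl_mem_colourAlg (j : J) (s : Fin d) :
    FreeAlgebra.ι ℂ (Sum.inl s) ∈ colourAlg κ d j := Algebra.subset_adjoin (Or.inl ⟨s, rfl⟩)

theorem inr_mem_colourAlg (i : I) :
    FreeAlgebra.ι ℂ (Sum.inr i) ∈ colourAlg κ d (κ i) := Algebra.subset_adjoin (Or.inr ⟨i, rfl, rfl⟩)

theorem colourAlg_le_range_relabel {I' : Type*} {ι : I' → I} {j : J}
    (hι : ∀ i, κ i = j → i ∈ Set.range ι) :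
    colourAlg κ d j ≤ (relabel ι : FreeAlgebra ℂ (Fin d ⊕ I') →ₐ[ℂ] _).range := by
  refine Algebra.adjoin_le (Set.union_subset ?_ ?_)
  · rintro _ ⟨s, rfl⟩; exact ⟨FreeAlgebra.ι ℂ (Sum.inl s), by simp [relabel]⟩
  · rintro _ ⟨i, hi, rfl⟩
    obtain ⟨i', rfl⟩ := hι i hi
    exact ⟨FreeAlgebra.ι ℂ (Sum.inr i'), by simp [relabel]⟩

variable {κ} {a} {B : J → Subalgebra ℂ A}

theorem eval_mem_of_mem_colourAlg {j : J} (hD : (S.D : Set A) ⊆ B j)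
    (ha : ∀ i, κ i = j → a i ∈ B j) {f : FreeAlgebra ℂ (Fin d ⊕ I)} (hf : f ∈ colourAlg κ d j) :
    S.eval a f ∈ B j := by
  have : colourAlg κ d j ≤ (B j).comap (S.eval a) := by
    refine Algebra.adjoin_le (Set.union_subset ?_ ?_)
    · rintro _ ⟨s, rfl⟩; simpa using hD (S.p_mem_D s)
    · rintro _ ⟨i, hi, rfl⟩; simpa using ha i hi
  exact this hf

variable [DecidableEq I] (r c : I → Fin d)

theorem diff_eq_zero_of_mem_colourAlg {i : I} {j : J} (hij : κ i ≠ j)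
    {f : FreeAlgebra ℂ (Fin d ⊕ I)} (hf : f ∈ colourAlg κ d j) : S.diff a r c i f = 0 := by
  induction hf using Algebra.adjoin_induction with
  | mem x hx =>
    rcases hx with ⟨s, rfl⟩ | ⟨i', hi', rfl⟩
    · simp
    · rw [diff_inr, if_neg]; rintro rfl; exact hij hi'
  | algebraMap t => simp [Algebra.algebraMap_eq_smul_one]
  | add x y _ _ hx hy => rw [map_add, hx, hy, add_zero]
  | mul x y _ _ hx hy => rw [diff_mul, hx, hy]; simp

theorem diff_mem_span_of_mem_colourAlg (i : I) {j : J} (hD : (S.D : Set A) ⊆ B j)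
    (ha : ∀ i, κ i = j → a i ∈ B j) {f : FreeAlgebra ℂ (Fin d ⊕ I)} (hf : f ∈ colourAlg κ d j) :
    S.diff a r c i f ∈ Submodule.span ℂ {T | ∃ u ∈ B j, ∃ v ∈ B j, u ⊗ₜ v = T} := by
  set V := Submodule.span ℂ {T | ∃ u ∈ B j, ∃ v ∈ B j, u ⊗ₜ[ℂ] v = T}
  have hev := fun f (hf : f ∈ colourAlg κ d j) ↦ S.eval_mem_of_mem_colourAlg hD ha hf
  induction hf using Algebra.adjoin_induction with
  | mem x hx =>
    rcases hx with ⟨s, rfl⟩ | ⟨i', hi', rfl⟩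
    · simp
    · rw [diff_inr]
      split_ifs
      · exact Submodule.subset_span ⟨_, hD (S.p_mem_D _), _, hD (S.p_mem_D _), rfl⟩
      · exact V.zero_mem
  | algebraMap t => simp [Algebra.algebraMap_eq_smul_one]
  | add x y _ _ hx hy => rw [map_add]; exact V.add_mem hx hy
  | mul x y hx' hy' hx hy =>
    rw [diff_mul]
    refine V.add_mem ?_ ?_
    · have : V ≤ V.comap (LinearMap.mulLeft ℂ (S.eval a x ⊗ₜ 1)) := by
        refine Submodule.span_le.2 ?_
        rintro _ ⟨u, hu, v, hv, rfl⟩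
        exact Submodule.subset_span ⟨_, mul_mem (hev x hx') hu, v, hv, by simp⟩
      exact this hy
    · have : V ≤ V.comap (LinearMap.mulRight ℂ (1 ⊗ₜ S.eval a y)) := by
        refine Submodule.span_le.2 ?_
        rintro _ ⟨u, hu, v, hv, rfl⟩
        exact Submodule.subset_span ⟨u, hu, _, mul_mem hv (hev y hy'), by simp⟩
      exact this hx

end Colour

/-! ### Alternating products span the free algebra -/

section Span

variable {I J : Type*} (a : I → A) (κ : I → J)

/-- The polynomials of a colour whose evaluation is centered. -/
def centeredPoly (j : J) : Set (FreeAlgebra ℂ (Fin d ⊕ I)) :=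
  {f | f ∈ colourAlg κ d j ∧ S.E (S.eval a f) = 0}

/-- The lift of `E (f (a))` to a polynomial in the letters for the projections. -/
def liftE (f : FreeAlgebra ℂ (Fin d ⊕ I)) : FreeAlgebra ℂ (Fin d ⊕ I) :=
  ∑ s, S.phi s (S.eval a f) • FreeAlgebra.ι ℂ (Sum.inl s)

theorem eval_liftE (f : FreeAlgebra ℂ (Fin d ⊕ I)) :
    S.eval a (S.liftE a f) = S.E (S.eval a f) := by
  simp [liftE, E]

theorem liftE_mem_colourAlg (j : J) (f : FreeAlgebra ℂ (Fin d ⊕ I)) :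
    S.liftE a f ∈ colourAlg κ d j :=
  Subalgebra.sum_mem _ fun s _ ↦ Subalgebra.smul_mem _ (inl_mem_colourAlg κ j s) _

variable {a κ}

theorem inl_mul_mem_centeredPoly {j : J} {f : FreeAlgebra ℂ (Fin d ⊕ I)} (s : Fin d)
    (hf : f ∈ S.centeredPoly a κ j) :
    FreeAlgebra.ι ℂ (Sum.inl s) * f ∈ S.centeredPoly a κ j :=
  ⟨mul_mem (inl_mem_colourAlg κ j s) hf.1, by rw [map_mul, eval_inl]; exact S.E_p_mul s hf.2⟩

theorem sub_liftE_mem_centeredPoly {j : J} {f : FreeAlgebra ℂ (Fin d ⊕ I)}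
    (hf : f ∈ colourAlg κ d j) : f - S.liftE a f ∈ S.centeredPoly a κ j :=
  ⟨sub_mem hf (S.liftE_mem_colourAlg a κ j f), by rw [map_sub, eval_liftE]; exact S.E_sub_E _⟩

/-- The span is stable under left multiplication by each letter. The letter either merges with a
first factor of its own colour or becomes a new first factor; in both cases that factor is
recentered, and the part removed lies in the span of the projection letters, which the next factor
absorbs. -/
theorem span_alt_eq_top [Nonempty J] :
    Submodule.span ℂ (Set.range (fun s ↦ FreeAlgebra.ι ℂ (Sum.inl s)) ∪
      {f | ∃ n i k, Alt (S.centeredPoly a κ) n i k f}) = ⊤ := by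
  set V := Submodule.span ℂ (Set.range (fun s ↦ FreeAlgebra.ι ℂ (Sum.inl s)) ∪
      {f | ∃ n i k, Alt (S.centeredPoly a κ) n i k f}) with hV
  have hp : ∀ s, FreeAlgebra.ι ℂ (Sum.inl s) ∈ V := fun s ↦ Submodule.subset_span (Or.inl ⟨s, rfl⟩)
  have halt : ∀ {n i k f}, Alt (S.centeredPoly a κ) n i k f → f ∈ V :=
    fun h ↦ Submodule.subset_span (Or.inr ⟨_, _, _, h⟩)
  have hE : ∀ f, S.liftE a f ∈ V := fun f ↦
    Submodule.sum_mem _ fun s _ ↦ Submodule.smul_mem _ _ (hp s)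
  have hcol : ∀ {j}, ∀ g ∈ colourAlg κ d j, g ∈ V := fun g hg ↦ by
    rw [← sub_add_cancel g (S.liftE a g)]
    exact V.add_mem (halt (.single (S.sub_liftE_mem_centeredPoly hg))) (hE g)
  have hmul : ∀ {j}, ∀ g ∈ colourAlg κ d j, ∀ {n i k f}, Alt (S.centeredPoly a κ) n i k f →
      j ≠ i → g * f ∈ V := by
    intro j g hg n i k f hf hji
    rw [← sub_add_cancel g (S.liftE a g), add_mul]
    refine V.add_mem (halt (.cons (S.sub_liftE_mem_centeredPoly hg) hji hf)) ?_
    rw [liftE, Finset.sum_mul]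
    refine Submodule.sum_mem _ fun s _ ↦ ?_
    rw [smul_mul_assoc]
    exact Submodule.smul_mem _ _ (halt (hf.mul_left fun _ _ ↦ S.inl_mul_mem_centeredPoly s))
  have hleft : ∀ {j}, ∀ g ∈ colourAlg κ d j, ∀ m ∈ V, g * m ∈ V := by
    intro j g hg
    suffices V ≤ V.comap (LinearMap.mulLeft ℂ g) from fun m hm ↦ this hm
    refine Submodule.span_le.2 ?_
    rintro _ (⟨s, rfl⟩ | ⟨n, i, k, hf⟩)
    · exact hcol _ (mul_mem hg (inl_mem_colourAlg κ j s))
    · by_cases hji : j = i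
      · subst hji
        cases hf with
        | single hz => exact hcol _ (mul_mem hg hz.1)
        | @cons _ _ _ _ z w hz hij hw =>
          change g * (z * w) ∈ V
          rw [← mul_assoc]; exact hmul _ (mul_mem hg hz.1) hw hij
      · exact hmul g hg hf hji
  have hall : ∀ f : FreeAlgebra ℂ (Fin d ⊕ I), ∀ m ∈ V, f * m ∈ V := by
    intro f
    induction f using FreeAlgebra.induction with
    | grade0 t =>
      intro m hm
      rw [Algebra.algebraMap_eq_smul_one, smul_mul_assoc, one_mul]; exact V.smul_mem t hm
    | grade1 s =>
      cases s with
      | inl s => exact hleft _ (inl_mem_colourAlg κ (Classical.arbitrary J) s)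
      | inr i => exact hleft _ (inr_mem_colourAlg κ i)
    | mul f g hf hg => intro m hm; rw [mul_assoc]; exact hf _ (hg _ hm)
    | add f g hf hg => intro m hm; rw [add_mul]; exact V.add_mem (hf _ hm) (hg _ hm)
  refine eq_top_iff.2 fun f _ ↦ ?_
  rw [← mul_one f]
  exact hall f 1 (hcol 1 (one_mem (colourAlg κ d (Classical.arbitrary J))))

end Span

/-! ### Conjugate systems of free families -/

section FreeFamilies

/-- The linear map `u ⊗ v ↦ φ (v) u`. -/
def slice : A ⊗[ℂ] A →ₗ[ℂ] A :=
  (TensorProduct.rid ℂ A).toLinearMap ∘ₗ TensorProduct.map LinearMap.id S.trace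

@[simp] theorem slice_tmul (u v : A) : S.slice (u ⊗ₜ v) = S.φ v • u := by simp [slice]

theorem slice_tmul_mul (u : A) (T : A ⊗[ℂ] A) : S.slice ((u ⊗ₜ 1) * T) = u * S.slice T := by
  induction T with
  | zero => simp
  | tmul a b => simp
  | add T T' h h' => simp only [mul_add, map_add, h, h']

theorem φ_slice (T : A ⊗[ℂ] A) : S.φ (S.slice T) = S.trace₂ T := by
  induction T with
  | zero => simp
  | tmul a b => simp [mul_comm]
  | add T T' h h' => simp only [map_add, h, h']

variable {I J : Type*} {a : I → A} {κ : I → J} {B : J → Subalgebra ℂ A} {r c : I → Fin d}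

theorem alt_eval {S : RectSpace A d} (hD : ∀ j, (S.D : Set A) ⊆ B j) (ha : ∀ i, a i ∈ B (κ i))
    {n : ℕ} {j k : J} {f : FreeAlgebra ℂ (Fin d ⊕ I)} (h : Alt (S.centeredPoly a κ) n j k f) :
    Alt (S.centered B) n j k (S.eval a f) :=
  Alt.map (Y := S.centered B) (S.eval a : FreeAlgebra ℂ (Fin d ⊕ I) →* A) (fun j _ hz ↦
    ⟨S.eval_mem_of_mem_colourAlg (hD j) (fun i hi ↦ hi ▸ ha i) hz.1, hz.2⟩) h

variable [DecidableEq I]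

/-- In the Leibniz expansion, differentiating any factor but the last leaves a right leg v w, with v
in the algebra of that factor and w alternating and starting in another colour, so φ kills it. Only
the derivative of the last factor survives. Its slice is a centered element plus an element of 𝒟,
and the latter is absorbed by the preceding factor if there is one. -/
theorem FreeSubalgebras.slice_diff {S : RectSpace A d} (hB : S.FreeSubalgebras B)
    (ha : ∀ i, a i ∈ B (κ i)) (i : I)
    {n : ℕ} {j k : J} {f : FreeAlgebra ℂ (Fin d ⊕ I)} (h : Alt (S.centeredPoly a κ) n j k f) :
    S.slice (S.diff a r c i f) ∈
      Submodule.span ℂ {u | ∃ n k, Alt (S.centered B) n j k u} ⊔ S.D ∧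
    (n ≠ 0 → S.slice (S.diff a r c i f) ∈
      Submodule.span ℂ {u | ∃ n k, Alt (S.centered B) n j k u}) := by
  obtain ⟨hD, hE⟩ := S.freeSubalgebras_iff.1 hB
  induction h with
  | @single j z hz =>
    refine ⟨?_, fun h ↦ absurd rfl h⟩
    have h1 : S.slice (S.diff a r c i z) ∈ B j := by
      have : Submodule.span ℂ {T | ∃ u ∈ B j, ∃ v ∈ B j, u ⊗ₜ[ℂ] v = T} ≤
          (B j).toSubmodule.comap S.slice := by
        refine Submodule.span_le.2 ?_
        rintro _ ⟨u, hu, v, hv, rfl⟩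
        simpa using Subalgebra.smul_mem _ hu _
      exact this (S.diff_mem_span_of_mem_colourAlg r c i (hD j) (fun i hi ↦ hi ▸ ha i) hz.1)
    rw [← sub_add_cancel (S.slice (S.diff a r c i z)) (S.E (S.slice (S.diff a r c i z)))]
    exact Submodule.add_mem_sup
      (Submodule.subset_span ⟨0, j, .single (sub_E_mem_centered hD h1)⟩) (S.E_mem_D _)
  | @cons n j l k z w hz hjl hw ih =>
    suffices h : S.slice (S.diff a r c i (z * w)) ∈
      Submodule.span ℂ {u | ∃ n k, Alt (S.centered B) n j k u} from
        ⟨Submodule.mem_sup_left h, fun _ ↦ h⟩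
    have hz' : S.eval a z ∈ S.centered B j :=
      ⟨S.eval_mem_of_mem_colourAlg (hD j) (fun i hi ↦ hi ▸ ha i) hz.1, hz.2⟩
    have h0 : S.slice (S.diff a r c i z * (1 ⊗ₜ S.eval a w)) = 0 := by
      have : Submodule.span ℂ {T | ∃ u ∈ B j, ∃ v ∈ B j, u ⊗ₜ[ℂ] v = T} ≤
          (S.slice ∘ₗ LinearMap.mulRight ℂ (1 ⊗ₜ S.eval a w)).ker := by
        refine Submodule.span_le.2 ?_
        rintro _ ⟨u, hu, v, hv, rfl⟩
        have := S.φ_eq_zero_of_E (E_mul_alt hD (fun m _ ↦ hE m) hv hjl (alt_eval hD ha hw))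
        simp [this]
      exact this (S.diff_mem_span_of_mem_colourAlg r c i (hD j) (fun i hi ↦ hi ▸ ha i) hz.1)
    rw [diff_mul, map_add, h0, add_zero, slice_tmul_mul]
    have : Submodule.span ℂ {u | ∃ n k, Alt (S.centered B) n l k u} ⊔ S.D ≤
        (Submodule.span ℂ {u | ∃ n k, Alt (S.centered B) n j k u}).comap
          (LinearMap.mulLeft ℂ (S.eval a z)) := by
      refine sup_le (Submodule.span_le.2 ?_) fun e he ↦ ?_
      · rintro u ⟨n, k, hu⟩
        exact Submodule.subset_span ⟨n + 1, k, .cons hz' hjl hu⟩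
      · exact Submodule.subset_span ⟨0, j, .single
          ⟨mul_mem hz'.1 (hD j he), S.E_mul_of_mem_D_right he hz'.2⟩⟩
    exact this ih.1

/-- If families are free, then the conjugate relations in one family imply the relations in the
union of the families. -/
theorem FreeSubalgebras.conjRel {S : RectSpace A d} (hB : S.FreeSubalgebras B)
    (ha : ∀ i, a i ∈ B (κ i)) {ξ : I → S.L2} {i : I} (hξ : ξ i ∈ S.closureL2 (B (κ i)))
    (h : ∀ f ∈ colourAlg κ d (κ i), S.ConjRel a r c ξ i f) (f : FreeAlgebra ℂ (Fin d ⊕ I)) :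
    S.ConjRel a r c ξ i f := by
  obtain ⟨hD, hE⟩ := S.freeSubalgebras_iff.1 hB
  have : Nonempty J := ⟨κ i⟩
  let θ : FreeAlgebra ℂ (Fin d ⊕ I) →ₗ[ℂ] ℂ :=
    S.φ (S.p (r i)) • S.pairing (ξ i) ∘ₗ (S.eval a).toLinearMap - S.trace₂ ∘ₗ S.diff a r c i
  have hθ : ∀ f, S.ConjRel a r c ξ i f ↔ f ∈ θ.ker := by
    intro f; rw [ConjRel, LinearMap.mem_ker, ← sub_eq_zero]; rfl
  -- Approximating `ξ i` from the algebra of its colour reduces the vanishing of the pairing to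
  -- freeness.
  have hpair : ∀ u, (∀ b ∈ B (κ i), S.φ (b * u) = 0) → S.pairing (ξ i) u = 0 := by
    intro u hu
    have : closure (S.toL2 '' (B (κ i) : Set A)) ⊆ {ζ | S.pairing ζ u = 0} :=
      closure_minimal (by rintro _ ⟨b, hb, rfl⟩; simpa [pairing_toL2] using hu b hb)
        (isClosed_eq (S.continuous_pairing u) continuous_const)
    exact this hξ
  suffices hker : θ.ker = ⊤ by rw [hθ, hker]; trivial
  rw [eq_top_iff, ← S.span_alt_eq_top (a := a) (κ := κ), Submodule.span_le]
  rintro f (⟨s, rfl⟩ | ⟨n, j, k, hf⟩)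
  · exact (hθ _).1 (h _ (inl_mem_colourAlg κ _ s))
  rw [SetLike.mem_coe, ← hθ]
  -- A single factor in the colour of i is covered by the hypothesis; in every other case both sides
  -- of the relation are zero.
  by_cases h0 : n = 0 ∧ j = κ i
  · obtain ⟨rfl, rfl⟩ := h0
    cases hf with
    | single hf => exact h f hf.1
  have h1 : S.pairing (ξ i) (S.eval a f) = 0 := by
    refine hpair _ fun b hb ↦ S.φ_eq_zero_of_E ?_
    by_cases hj : j = κ i
    · subst hj
      cases hf with
      | single _ => simp at h0
      | cons hz hjl hw =>
        rw [map_mul, ← mul_assoc]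
        exact E_mul_alt hD (fun m _ ↦ hE m) (mul_mem hb (S.eval_mem_of_mem_colourAlg (hD _)
          (fun i hi ↦ hi ▸ ha i) hz.1)) hjl (alt_eval hD ha hw)
    · exact E_mul_alt hD (fun m _ ↦ hE m) hb (Ne.symm hj) (alt_eval hD ha hf)
  have h2 : S.trace₂ (S.diff a r c i f) = 0 := by
    by_cases hn : n = 0
    · subst hn
      cases hf with
      | single hf =>
        rw [S.diff_eq_zero_of_mem_colourAlg r c (fun h ↦ h0 ⟨rfl, h.symm⟩) hf.1, map_zero]
    · have hle : Submodule.span ℂ {u | ∃ n k, Alt (S.centered B) n j k u} ≤ S.kerE :=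
        Submodule.span_le.2 (by rintro u ⟨n, k, hu⟩; exact hE _ _ _ _ hu)
      rw [← φ_slice]
      exact S.φ_eq_zero_of_E (hle ((hB.slice_diff ha i hf).2 hn))
  rw [ConjRel, h1, h2, mul_zero]

end FreeFamilies

end RectSpace

namespace RectSpace

variable {A : Type*} [CStarAlgebra A] [PartialOrder A] [StarOrderedRing A] {d : ℕ}
  (S : RectSpace A d)

/-! ### The liberation derivation -/

section Liberation

variable {I J : Type*} [DecidableEq I] (a : I → A) (r c : I → Fin d) (s : Finset I)

/-- The tensor `∑ t, p t ⊗ p t`, the unit of `A` amalgamated with `A` over `𝒟`. -/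
def diagTensor : A ⊗[ℂ] A := ∑ t, S.p t ⊗ₜ S.p t

theorem trace₂_diagTensor (u v : A) :
    S.trace₂ ((u ⊗ₜ 1) * S.diagTensor * (1 ⊗ₜ v)) = ∑ t, S.φ (S.p t * u) * S.φ (S.p t * v) := by
  rw [diagTensor, Finset.mul_sum, Finset.sum_mul, map_sum]
  refine Finset.sum_congr rfl fun t _ ↦ ?_
  simp [S.tracial u]

theorem trace₂_diagTensor_eq_zero {u : A} (hu : S.E u = 0) (v : A) :
    S.trace₂ ((u ⊗ₜ 1) * S.diagTensor * (1 ⊗ₜ v)) = 0 := by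
  rw [trace₂_diagTensor]
  exact Finset.sum_eq_zero fun t _ ↦ by rw [(S.E_eq_zero_iff u).1 hu t, zero_mul]

/-- The derivation which is the commutator with `diagTensor` on the letters `a i` for `i ∈ s`, and
vanishes on the other ones. -/
def liberation : FreeAlgebra ℂ (Fin d ⊕ I) →ₗ[ℂ] A ⊗[ℂ] A :=
  ∑ i ∈ s, (inner 1 (a i) - inner (a i) 1) ∘ₗ S.diff a r c i

theorem liberation_apply (f : FreeAlgebra ℂ (Fin d ⊕ I)) : S.liberation a r c s f =
    ∑ i ∈ s, (inner 1 (a i) (S.diff a r c i f) - inner (a i) 1 (S.diff a r c i f)) := by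
  simp [liberation]

theorem liberation_mul (f g : FreeAlgebra ℂ (Fin d ⊕ I)) :
    S.liberation a r c s (f * g) = (S.eval a f ⊗ₜ 1) * S.liberation a r c s g +
      S.liberation a r c s f * (1 ⊗ₜ S.eval a g) := by
  simp only [liberation_apply, Finset.mul_sum, Finset.sum_mul, ← Finset.sum_add_distrib]
  refine Finset.sum_congr rfl fun i _ ↦ ?_
  simp only [diff_mul, map_add, inner_tmul_mul, inner_mul_tmul, mul_sub, sub_mul]
  abel

variable {a r c s} {κ : I → J} {j₀ : J}

theorem liberation_of_ne (hs : ∀ i, i ∈ s ↔ κ i = j₀) {j : J} (hj : j ≠ j₀)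
    {f : FreeAlgebra ℂ (Fin d ⊕ I)} (hf : f ∈ colourAlg κ d j) :
    S.liberation a r c s f = 0 := by
  rw [liberation_apply]
  refine Finset.sum_eq_zero fun i hi ↦ ?_
  rw [S.diff_eq_zero_of_mem_colourAlg r c (fun h ↦ hj (h.symm.trans ((hs i).1 hi))) hf]
  simp

/-- Both sides are derivations, so they need only be compared on generators. The commutator with
`diagTensor` kills the projections and sends a_i to p_{r(i)} ⊗ a_i - a_i ⊗ p_{c(i)}. -/
theorem liberation_of_mem (ha : ∀ i, a i ∈ S.corner (r i) (c i)) (hs : ∀ i, i ∈ s ↔ κ i = j₀)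
    {f : FreeAlgebra ℂ (Fin d ⊕ I)} (hf : f ∈ colourAlg κ d j₀) :
    S.liberation a r c s f =
      S.diagTensor * (1 ⊗ₜ S.eval a f) - (S.eval a f ⊗ₜ 1) * S.diagTensor := by
  induction hf using Algebra.adjoin_induction with
  | mem x hx =>
    rcases hx with ⟨t, rfl⟩ | ⟨i, hi, rfl⟩
    · simp [liberation_apply, diagTensor, Finset.sum_mul, Finset.mul_sum, p_mul_p,
        TensorProduct.tmul_ite, TensorProduct.ite_tmul]
    · have h1 := S.p_mul_of_mem_corner (ha i)
      have h2 := S.mul_p_of_mem_corner (ha i)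
      have h3 : S.liberation a r c s (FreeAlgebra.ι ℂ (Sum.inr i)) =
          S.p (r i) ⊗ₜ a i - a i ⊗ₜ S.p (c i) := by
        rw [liberation_apply, Finset.sum_eq_single i]
        · simp [h1, h2]
        · intro i' _ hi'; simp [hi']
        · intro h; exact absurd ((hs i).2 hi) h
      have h4 : S.diagTensor * (1 ⊗ₜ a i) = S.p (r i) ⊗ₜ a i := by
        rw [diagTensor, Finset.sum_mul, Finset.sum_eq_single (r i)]
        · simp [h1]
        · intro t _ ht
          rw [← h1, Algebra.TensorProduct.tmul_mul_tmul, ← mul_assoc, S.orthogonal _ _ ht]; simp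
        · simp
      have h5 : (a i ⊗ₜ 1) * S.diagTensor = a i ⊗ₜ S.p (c i) := by
        rw [diagTensor, Finset.mul_sum, Finset.sum_eq_single (c i)]
        · simp [h2]
        · intro t _ ht
          rw [← h2, Algebra.TensorProduct.tmul_mul_tmul, mul_assoc, S.orthogonal _ _ (Ne.symm ht)]
          simp
        · simp
      rw [h3, eval_inr, h4, h5]
  | algebraMap t =>
    have h1 : (1 : A) ⊗ₜ[ℂ] (t • (1 : A)) = t • 1 := by
      rw [TensorProduct.tmul_smul, Algebra.TensorProduct.one_def]
    have h2 : (t • (1 : A)) ⊗ₜ[ℂ] (1 : A) = t • 1 := by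
      rw [← TensorProduct.smul_tmul', Algebra.TensorProduct.one_def]
    rw [AlgHom.commutes, Algebra.algebraMap_eq_smul_one, Algebra.algebraMap_eq_smul_one, h1, h2]
    simp [liberation_apply]
  | add x y _ _ hx hy =>
    rw [map_add, hx, hy, map_add, TensorProduct.tmul_add, TensorProduct.add_tmul, mul_add, add_mul]
    abel
  | mul x y _ _ hx hy =>
    have h1 : (1 : A) ⊗ₜ[ℂ] (S.eval a x * S.eval a y) = (1 ⊗ₜ S.eval a x) * (1 ⊗ₜ S.eval a y) := by
      simp
    have h2 : (S.eval a x * S.eval a y) ⊗ₜ[ℂ] (1 : A) = (S.eval a x ⊗ₜ 1) * (S.eval a y ⊗ₜ 1) := by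
      simp
    rw [liberation_mul, hx, hy, map_mul, h1, h2]
    noncomm_ring

/-- The integral of the liberation derivation is given by the commutators of the family with its
conjugate system. -/
theorem trace₂_liberation {ξ : I → S.L2} (hrel : ∀ i ∈ s, ∀ f, S.ConjRel a r c ξ i f)
    (hbal : ∀ u, ∑ i ∈ s, (S.φ (S.p (r i)) * S.φ (S.p (c i) * u) -
      S.φ (S.p (c i)) * S.φ (S.p (r i) * u)) = 0) (f : FreeAlgebra ℂ (Fin d ⊕ I)) :
    S.trace₂ (S.liberation a r c s f) = S.pairing (∑ i ∈ s, S.φ (S.p (r i)) •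
      (S.lmul (a i) (ξ i) - S.rmul (a i) (ξ i))) (S.eval a f) := by
  have h1 : S.pairing (∑ i ∈ s, S.φ (S.p (r i)) • (S.lmul (a i) (ξ i) - S.rmul (a i) (ξ i)))
      (S.eval a f) = ∑ i ∈ s, S.φ (S.p (r i)) * (S.pairing (ξ i) (S.eval a f * a i) -
        S.pairing (ξ i) (a i * S.eval a f)) := by
    rw [pairing_apply, inner_sum]
    refine Finset.sum_congr rfl fun i _ ↦ ?_
    rw [inner_smul_right, inner_sub_right, ← pairing_apply, ← pairing_apply, pairing_lmul,
      pairing_rmul]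
  rw [h1, ← add_zero (∑ i ∈ s, S.φ (S.p (r i)) * _), ← hbal (S.eval a f), ← Finset.sum_add_distrib,
    liberation_apply, map_sum]
  refine Finset.sum_congr rfl fun i hi ↦ ?_
  -- Applied to f a_i and a_i f, the relation produces the two terms of the derivation, plus
  -- boundary terms where the added letter itself is differentiated. The boundary terms cancel in
  -- total by `hbal`.
  have h2 := hrel i hi (f * FreeAlgebra.ι ℂ (Sum.inr i))
  have h3 := hrel i hi (FreeAlgebra.ι ℂ (Sum.inr i) * f)
  simp only [ConjRel, diff_mul, map_mul, eval_inr, diff_inr, if_true, map_add,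
    Algebra.TensorProduct.tmul_mul_tmul, one_mul, mul_one, trace₂_tmul] at h2 h3
  rw [S.tracial (S.eval a f)] at h2
  rw [map_sub, trace₂_inner, trace₂_inner, ← Algebra.TensorProduct.one_def, one_mul, mul_one,
    mul_sub, h2, h3]
  ring

end Liberation

/-! ### Freeness from the vanishing of the liberation gradient -/

section Converse

variable {I J : Type*} [DecidableEq I] {a : I → A} {r c : I → Fin d} {s : Finset I} {κ : I → J}
  {j₀ : J}

omit [DecidableEq I] in
theorem exists_alt_eval {n : ℕ} {j k : J} {u : A}
    (h : Alt (S.centered fun j ↦ (colourAlg κ d j).map (S.eval a)) n j k u) :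
    ∃ f, Alt (S.centeredPoly a κ) n j k f ∧ S.eval a f = u := by
  induction h with
  | single hz =>
    obtain ⟨⟨f, hf, rfl⟩, h0⟩ := hz
    exact ⟨f, .single ⟨hf, h0⟩, rfl⟩
  | cons hz hij _ ih =>
    obtain ⟨⟨f, hf, rfl⟩, h0⟩ := hz
    obtain ⟨g, hg, rfl⟩ := ih
    exact ⟨f * g, .cons ⟨hf, h0⟩ hij hg, map_mul _ _ _⟩

open Classical in
-- The expansion is a sum of terms prefix · `diagTensor` · suffix, and each vanishes when its prefix
-- is centered. By hypothesis this covers every proper prefix of u f that occurs; only the cut after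
-- the last factor can survive, and it occurs, with a minus sign, exactly when that factor has
-- colour j₀.
theorem trace₂_mul_liberation (ha : ∀ i, a i ∈ S.corner (r i) (c i))
    (hs : ∀ i, i ∈ s ↔ κ i = j₀) {n m : ℕ} {q k i l : J} {f : FreeAlgebra ℂ (Fin d ⊕ I)} {u : A}
    (hE : ∀ t ≤ m + n, ∀ i k u,
      Alt (S.centered fun j ↦ (colourAlg κ d j).map (S.eval a)) t i k u → S.E u = 0)
    (hf : Alt (S.centeredPoly a κ) n q k f)
    (hu : Alt (S.centered fun j ↦ (colourAlg κ d j).map (S.eval a)) m i l u) (hlq : l ≠ q) :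
    S.trace₂ ((u ⊗ₜ 1) * S.liberation a r c s f) =
      if k = j₀ then - S.trace₂ (((u * S.eval a f) ⊗ₜ 1) * S.diagTensor) else 0 := by
  induction hf generalizing m l u with
  | @single q z hz =>
    split_ifs with hq
    · subst hq
      have h1 := S.trace₂_diagTensor_eq_zero (hE m le_rfl _ _ _ hu) (S.eval a z)
      rw [S.liberation_of_mem ha hs hz.1, mul_sub, map_sub, ← mul_assoc, ← mul_assoc, h1, zero_sub]
      simp
    · rw [S.liberation_of_ne hs hq hz.1]; simp
  | @cons n q q' k z w hz hq hw ih =>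
    have hz' : S.eval a z ∈ S.centered (fun j ↦ (colourAlg κ d j).map (S.eval a)) q :=
      ⟨⟨z, hz.1, rfl⟩, hz.2⟩
    have hu' := hu.snoc hz' hlq
    have h1 : S.trace₂ ((u ⊗ₜ 1) * (S.liberation a r c s z * (1 ⊗ₜ S.eval a w))) = 0 := by
      by_cases hj : q = j₀
      · subst hj
        have h2 := S.trace₂_diagTensor_eq_zero (hE m (by omega) _ _ _ hu)
          (S.eval a z * S.eval a w)
        have h3 := S.trace₂_diagTensor_eq_zero (hE (m + 1) (by omega) _ _ _ hu') (S.eval a w)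
        have h4 : (u ⊗ₜ[ℂ] (1 : A)) * ((S.diagTensor * (1 ⊗ₜ S.eval a z) -
            (S.eval a z ⊗ₜ 1) * S.diagTensor) * (1 ⊗ₜ S.eval a w)) =
            (u ⊗ₜ 1) * S.diagTensor * (1 ⊗ₜ (S.eval a z * S.eval a w)) -
            ((u * S.eval a z) ⊗ₜ 1) * S.diagTensor * (1 ⊗ₜ S.eval a w) := by
          have h5 : (1 : A) ⊗ₜ[ℂ] (S.eval a z * S.eval a w) =
            (1 ⊗ₜ S.eval a z) * (1 ⊗ₜ S.eval a w) := by simp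
          have h6 : (u * S.eval a z) ⊗ₜ[ℂ] (1 : A) = (u ⊗ₜ 1) * (S.eval a z ⊗ₜ 1) := by simp
          rw [h5, h6]; noncomm_ring
        rw [S.liberation_of_mem ha hs hz.1, h4, map_sub, h2, h3, sub_zero]
      · rw [S.liberation_of_ne hs hj hz.1]; simp
    have h2 := ih (fun t ht ↦ hE t (by omega)) hu' hq
    have h3 : (u ⊗ₜ[ℂ] (1 : A)) * ((S.eval a z ⊗ₜ 1) * S.liberation a r c s w) =
        ((u * S.eval a z) ⊗ₜ 1) * S.liberation a r c s w := by
      rw [← mul_assoc]; simp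
    rw [liberation_mul, mul_add, map_add, h1, add_zero, h3, h2, map_mul (S.eval a),
      mul_assoc u]

theorem freeSubalgebras_of_trace₂_liberation (ha : ∀ i, a i ∈ S.corner (r i) (c i))
    (hs : ∀ i, i ∈ s ↔ κ i = j₀) (hJ : ∀ j k : J, j ≠ k → j = j₀ ∨ k = j₀)
    (hlib : ∀ f, S.trace₂ (S.liberation a r c s f) = 0) :
    S.FreeSubalgebras fun j ↦ (colourAlg κ d j).map (S.eval a) := by
  have hD : ∀ j, (S.D : Set A) ⊆ (colourAlg κ d j).map (S.eval a) := by
    intro j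
    have : S.D ≤ ((colourAlg κ d j).map (S.eval a)).toSubmodule := by
      refine Submodule.span_le.2 ?_
      rintro _ ⟨t, rfl⟩
      exact ⟨_, inl_mem_colourAlg κ j t, S.eval_inl a t⟩
    exact this
  refine S.freeSubalgebras_iff.2 ⟨hD, fun n ↦ ?_⟩
  induction n using Nat.strong_induction_on with
  | _ n IH =>
  cases n with
  | zero => intro i k u hu; cases hu with
    | single hu => exact hu.2
  | succ n =>
  -- When the end colours differ, exactly one end has colour j₀. A single cut, before the first
  -- factor or after the last, then survives in the vanishing trace.
  have hne : ∀ j k, j ≠ k → ∀ f, Alt (S.centeredPoly a κ) (n + 1) j k f →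
      ∑ t, S.φ (S.p t) * S.φ (S.p t * S.eval a f) = 0 := by
    intro j k hjk f hf
    cases hf with
    | @cons _ _ l _ z w hz hjl hw =>
    have hz' : S.eval a z ∈ S.centered (fun j ↦ (colourAlg κ d j).map (S.eval a)) j :=
      ⟨⟨z, hz.1, rfl⟩, hz.2⟩
    have h1 := S.trace₂_mul_liberation ha hs (fun t ht ↦ IH t (by omega)) hw (.single hz') hjl
    have h2 := hlib (z * w)
    rw [liberation_mul, map_add, h1] at h2
    rcases hJ j k hjk with rfl | rfl
    · rw [if_neg (Ne.symm hjk), zero_add, S.liberation_of_mem ha hs hz.1, sub_mul, map_sub,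
        S.trace₂_diagTensor_eq_zero hz.2, sub_zero, mul_assoc,
        Algebra.TensorProduct.tmul_mul_tmul, mul_one] at h2
      have h3 := S.trace₂_diagTensor 1 (S.eval a z * S.eval a w)
      rw [← Algebra.TensorProduct.one_def, one_mul, h2] at h3
      simpa using h3.symm
    · rw [if_pos rfl, S.liberation_of_ne hs hjk hz.1, zero_mul, map_zero, add_zero] at h2
      have h3 := S.trace₂_diagTensor (S.eval a z * S.eval a w) 1
      rw [← Algebra.TensorProduct.one_def, mul_one, neg_eq_zero.1 h2] at h3
      simpa [mul_comm] using h3.symm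
  -- When the end colours agree, traciality rotates the last factor to the front, where it merges
  -- with the first. The product is shorter, and its first factor need not be centered.
  have heq : ∀ j u, Alt (S.centered fun j ↦ (colourAlg κ d j).map (S.eval a)) (n + 1) j j u →
      S.φ u = 0 := by
    intro j u hu
    cases hu with
    | @cons _ _ l _ z w hz hjl hw =>
    cases n with
    | zero => cases hw with
      | single _ => exact absurd rfl hjl
    | succ n =>
    obtain ⟨q, v, y, hv, hy, -, rfl⟩ := hw.exists_snoc
    rw [← mul_assoc, S.tracial, ← mul_assoc]
    exact S.φ_eq_zero_of_E (E_mul_alt hD (fun m hm ↦ IH m (by omega)) (mul_mem hy.1 hz.1) hjl hv)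
  intro j k u hu
  rw [E_eq_zero_iff]
  intro t
  by_cases hjk : j = k
  · subst hjk
    exact heq j _ (hu.mul_left fun j z hz ↦ mul_mem_centered hD (S.p_mem_D t) hz)
  · obtain ⟨f, hf, rfl⟩ := S.exists_alt_eval hu
    -- Multiplying by p_t on the left isolates the term of index t in the sum.
    have h1 := hne j k hjk _ (hf.mul_left fun j z hz ↦ S.inl_mul_mem_centeredPoly t hz)
    rw [Finset.sum_eq_single t] at h1
    · rw [map_mul (S.eval a), eval_inl, ← mul_assoc, p_mul_self] at h1
      exact (mul_eq_zero.1 h1).resolve_left (S.φ_p_ne_zero t)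
    · intro t' _ ht'
      rw [map_mul (S.eval a), eval_inl, ← mul_assoc, S.orthogonal _ _ ht']; simp
    · simp

/-- If the conjugate vectors of the letters of a colour belong to the closure of the algebra of
this colour, then this algebra is free from the algebra of the other colour. -/
theorem freeSubalgebras_of_conjRel (ha : ∀ i, a i ∈ S.corner (r i) (c i))
    (hs : ∀ i, i ∈ s ↔ κ i = j₀) (hJ : ∀ j k : J, j ≠ k → j = j₀ ∨ k = j₀)
    (hstar : ∀ b ∈ (colourAlg κ d j₀).map (S.eval a), star b ∈ (colourAlg κ d j₀).map (S.eval a))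
    {ξ : I → S.L2} (hrel : ∀ i ∈ s, ∀ f, S.ConjRel a r c ξ i f)
    (hξ : ∀ i ∈ s, ξ i ∈ S.closureL2 ((colourAlg κ d j₀).map (S.eval a)))
    (hbal : ∀ u, ∑ i ∈ s, (S.φ (S.p (r i)) * S.φ (S.p (c i) * u) -
      S.φ (S.p (c i)) * S.φ (S.p (r i) * u)) = 0) :
    S.FreeSubalgebras fun j ↦ (colourAlg κ d j).map (S.eval a) := by
  refine S.freeSubalgebras_of_trace₂_liberation ha hs hJ fun f ↦ ?_
  have h1 := S.trace₂_liberation hrel hbal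
  have h0 : ∑ i ∈ s, S.φ (S.p (r i)) • (S.lmul (a i) (ξ i) - S.rmul (a i) (ξ i)) = 0 := by
    refine S.eq_of_pairing_eq hstar (Submodule.sum_mem _ fun i hi ↦ Submodule.smul_mem _ _ ?_)
      (Submodule.zero_mem _) ?_
    · have : a i ∈ (colourAlg κ d j₀).map (S.eval a) :=
        ⟨_, (hs i).1 hi ▸ inr_mem_colourAlg κ i, S.eval_inr a i⟩
      exact Submodule.sub_mem _ (S.lmul_mem_closureL2 this (hξ i hi))
        (S.rmul_mem_closureL2 this (hξ i hi))
    -- On the algebra of colour j₀ the derivation is a commutator with `diagTensor`, and both of its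
    -- terms have trace ∑ φ(p_t) φ(p_t g).
    · rintro _ ⟨g, hg, rfl⟩
      refine (h1 g).symm.trans ?_
      have h2 := S.trace₂_diagTensor 1 (S.eval a g)
      have h3 := S.trace₂_diagTensor (S.eval a g) 1
      rw [← Algebra.TensorProduct.one_def, one_mul] at h2
      rw [← Algebra.TensorProduct.one_def, mul_one] at h3
      rw [S.liberation_of_mem ha hs hg, map_sub, h2, h3]
      simp [pairing_apply, mul_comm]
  rw [h1, h0]
  simp [pairing_apply]

end Converse

end RectSpace

namespace RectSpace

variable {A : Type*} [CStarAlgebra A] [PartialOrder A] [StarOrderedRing A] {d : ℕ}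
  {S : RectSpace A d}

/-! ### Unions of families -/

section Union

variable {I J K : Type*} {a : I → A} {κ : I → J} {ι : J → K → I}

theorem alg_comp_eq_map_colourAlg {j : J} (hι : ∀ i, κ i = j ↔ i ∈ Set.range (ι j)) :
    S.alg (a ∘ ι j) = (colourAlg κ d j).map (S.eval a) := by
  apply le_antisymm
  · refine Algebra.adjoin_le (Set.union_subset ?_ ?_)
    · rintro _ ⟨t, rfl⟩
      refine ⟨_, ?_, S.eval_inr a (ι j t)⟩
      have := inr_mem_colourAlg (d := d) κ (ι j t)
      rwa [(hι _).2 ⟨t, rfl⟩] at this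
    · have : S.D ≤ ((colourAlg κ d j).map (S.eval a)).toSubmodule := by
        refine Submodule.span_le.2 ?_
        rintro _ ⟨t, rfl⟩
        exact ⟨_, inl_mem_colourAlg κ j t, S.eval_inl a t⟩
      exact this
  · rintro _ ⟨f, hf, rfl⟩
    refine S.eval_mem_of_mem_colourAlg (B := fun _ : J ↦ S.alg (a ∘ ι j))
      (fun e he ↦ Algebra.subset_adjoin (Or.inr he)) (fun i hi ↦ ?_) hf
    obtain ⟨t, rfl⟩ := (hι i).1 hi
    exact S.mem_alg t

variable [DecidableEq I] [DecidableEq K]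

/-- Conjugate systems of free families form a conjugate system of the union of the families. -/
theorem FreeSubalgebras.isConjugateSystem {B : J → Subalgebra ℂ A} (hB : S.FreeSubalgebras B)
    (ha : ∀ i, a i ∈ B (κ i)) (hinj : ∀ j, Function.Injective (ι j))
    (hι : ∀ j i, κ i = j ↔ i ∈ Set.range (ι j)) {ξ : I → S.L2}
    (hξ : ∀ j, S.IsConjugateSystem (a ∘ ι j) (ξ ∘ ι j)) : S.IsConjugateSystem a ξ := by
  -- Each subfamily comes with its own index functions. They are chosen here letter by letter for
  -- the union, and matched again later through `corner_unique`.
  have h1 : ∀ i, ∃ r c, a i ≠ 0 ∧ a i ∈ S.corner r c ∧ ξ i ∈ S.cornerL2 c r := by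
    intro i
    obtain ⟨t, ht⟩ := (hι (κ i) i).1 rfl
    obtain ⟨r, c, h1, h2, -⟩ := S.conjugateRelations_iff.1 (hξ (κ i)).1
    have h3 := h1 t
    have h4 := h2 t
    simp only [Function.comp_apply, ht] at h3 h4
    exact ⟨r t, c t, h3.1, h3.2, h4⟩
  choose r c h0 hac hξc using h1
  have hmem : ∀ i, ξ i ∈ S.closureL2 (S.alg (a ∘ ι (κ i))) := by
    intro i
    obtain ⟨t, ht⟩ := (hι (κ i) i).1 rfl
    have := (hξ (κ i)).2 t
    rw [Function.comp_apply, ht] at this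
    exact this
  refine ⟨S.conjugateRelations_iff.2 ⟨r, c, fun i ↦ ⟨h0 i, hac i⟩, hξc, fun i f ↦ ?_⟩,
    fun i ↦ S.closureL2_mono (S.alg_comp_le _) (hmem i)⟩
  refine hB.conjRel ha (S.closureL2_mono (Algebra.adjoin_le (Set.union_subset ?_ (hB.1 _)))
    (hmem i)) (fun f hf ↦ ?_) f
  · rintro _ ⟨t, rfl⟩
    have := ha (ι (κ i) t)
    rwa [(hι _ _).2 ⟨t, rfl⟩] at this
  · obtain ⟨g, rfl⟩ := colourAlg_le_range_relabel κ (fun i' hi' ↦ (hι (κ i) i').1 hi') hf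
    obtain ⟨t, ht⟩ := (hι (κ i) i).1 rfl
    obtain ⟨r', c', h1, -, h3⟩ := S.conjugateRelations_iff.1 (hξ (κ i)).1
    have hr : r' = r ∘ ι (κ i) := funext fun u ↦ (S.corner_unique (h1 u).1 (h1 u).2 (hac _)).1
    have hc : c' = c ∘ ι (κ i) := funext fun u ↦ (S.corner_unique (h1 u).1 (h1 u).2 (hac _)).2
    have h4 := (S.conjRel_relabel_iff (hinj _) (r := r) (c := c) ξ t g).2 (hr ▸ hc ▸ h3 t g)
    rwa [ht] at h4

end Union

/-! ### Pairs -/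

section Pair

variable {x y : A}

/-- The family `x, y, x*, y*` contains the families `x, x*` and `y, y*`. -/
def pairEmb : Fin 2 → Fin 2 → Fin 4 := ![![0, 2], ![1, 3]]

/-- The colours of the elements of the family `x, y, x*, y*`. -/
def pairColour : Fin 4 → Fin 2 := ![0, 1, 0, 1]

theorem pairEmb_injective (j : Fin 2) : Function.Injective (pairEmb j) := by
  revert j; decide

theorem pairColour_eq_iff (j : Fin 2) (i : Fin 4) :
    pairColour i = j ↔ i ∈ Set.range (pairEmb j) := by
  simp only [Set.mem_range]; revert i j; decide

omit [PartialOrder A] [StarOrderedRing A] in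
theorem pair_comp_zero : ![x, y, star x, star y] ∘ pairEmb 0 = ![x, star x] := by
  funext i; fin_cases i <;> rfl

omit [PartialOrder A] [StarOrderedRing A] in
theorem pair_comp_one : ![x, y, star x, star y] ∘ pairEmb 1 = ![y, star y] := by
  funext i; fin_cases i <;> rfl

omit [PartialOrder A] [StarOrderedRing A] in
theorem star_mem_range_pair (x : A) (i : Fin 2) :
    star (![x, star x] i) ∈ Set.range ![x, star x] := by
  fin_cases i
  · exact ⟨1, rfl⟩
  · exact ⟨0, by simp⟩

omit [PartialOrder A] [StarOrderedRing A] in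
theorem star_mem_range_pairs (i : Fin 4) :
    star (![x, y, star x, star y] i) ∈ Set.range ![x, y, star x, star y] := by
  fin_cases i
  · exact ⟨2, rfl⟩
  · exact ⟨3, rfl⟩
  · exact ⟨0, by simp⟩
  · exact ⟨1, by simp⟩

omit [PartialOrder A] [StarOrderedRing A] in
theorem star_mem_range_pair_comp (j i : Fin 2) :
    star ((![x, y, star x, star y] ∘ pairEmb j) i) ∈
      Set.range (![x, y, star x, star y] ∘ pairEmb j) := by
  fin_cases j
  · simp only [Fin.zero_eta, pair_comp_zero]; exact star_mem_range_pair x i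
  · simp only [Fin.mk_one, pair_comp_one]; exact star_mem_range_pair y i

theorem IsConjugateSystem.fisher_pair {ξ : Fin 4 → S.L2}
    (hξ : S.IsConjugateSystem ![x, y, star x, star y] ξ) :
    S.fisher ![x, y, star x, star y] =
      ENNReal.ofReal (‖ξ 0‖ ^ 2 + ‖ξ 2‖ ^ 2 + (‖ξ 1‖ ^ 2 + ‖ξ 3‖ ^ 2)) ∧
    S.fisher ![x, star x] + S.fisher ![y, star y] = ENNReal.ofReal
      (‖(S.closureL2 (S.alg ![x, star x])).starProjection (ξ 0)‖ ^ 2 +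
       ‖(S.closureL2 (S.alg ![x, star x])).starProjection (ξ 2)‖ ^ 2 +
      (‖(S.closureL2 (S.alg ![y, star y])).starProjection (ξ 1)‖ ^ 2 +
       ‖(S.closureL2 (S.alg ![y, star y])).starProjection (ξ 3)‖ ^ 2)) := by
  have h0 := (hξ.restrict (pairEmb_injective 0) (star_mem_range_pair_comp 0)).fisher_eq
    (star_mem_range_pair_comp 0)
  have h1 := (hξ.restrict (pairEmb_injective 1) (star_mem_range_pair_comp 1)).fisher_eq
    (star_mem_range_pair_comp 1)
  rw [pair_comp_zero] at h0
  rw [pair_comp_one] at h1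
  rw [h0, h1, hξ.fisher_eq star_mem_range_pairs, tsum_fintype, tsum_fintype, tsum_fintype,
    Fin.sum_univ_two, Fin.sum_univ_two, Fin.sum_univ_four, ENNReal.ofReal_add (by positivity)
    (by positivity), ENNReal.ofReal_add (by positivity) (by positivity), ENNReal.ofReal_add
    (by positivity) (by positivity), ENNReal.ofReal_add (by positivity)
    (by positivity), ENNReal.ofReal_add (by positivity) (by positivity), ENNReal.ofReal_add
    (by positivity) (by positivity)]
  exact ⟨by ring, rfl⟩

theorem fisher_pair_le :
    S.fisher ![x, star x] + S.fisher ![y, star y] ≤ S.fisher ![x, y, star x, star y] := by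
  by_cases h : S.fisher ![x, y, star x, star y] = ∞
  · rw [h]; exact le_top
  obtain ⟨ξ, hξ⟩ := S.exists_isConjugateSystem_of_fisher_ne_top h
  rw [hξ.fisher_pair.1, hξ.fisher_pair.2]
  apply ENNReal.ofReal_le_ofReal
  gcongr <;> exact Submodule.norm_starProjection_apply_le _ _

theorem FreePair.fisher_eq (h : S.FreePair x y) :
    S.fisher ![x, y, star x, star y] = S.fisher ![x, star x] + S.fisher ![y, star y] := by
  refine le_antisymm ?_ fisher_pair_le
  by_cases hx : S.fisher ![x, star x] = ∞
  · rw [hx, top_add]; exact le_top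
  by_cases hy : S.fisher ![y, star y] = ∞
  · rw [hy, add_top]; exact le_top
  obtain ⟨ξ, hξ⟩ := S.exists_isConjugateSystem_of_fisher_ne_top hx
  obtain ⟨η, hη⟩ := S.exists_isConjugateSystem_of_fisher_ne_top hy
  obtain ⟨B, hB, hfree⟩ := h
  have hc : S.IsConjugateSystem ![x, y, star x, star y] ![ξ 0, η 0, ξ 1, η 1] := by
    refine hfree.isConjugateSystem (κ := pairColour) (ι := pairEmb) (fun i ↦ ?_) pairEmb_injective
      pairColour_eq_iff fun j ↦ ?_
    · fin_cases i
      · exact hB 0 (Or.inl rfl)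
      · exact hB 1 (Or.inl rfl)
      · exact hB 0 (Or.inr rfl)
      · exact hB 1 (Or.inr rfl)
    · fin_cases j
      · have : ![ξ 0, η 0, ξ 1, η 1] ∘ pairEmb 0 = ξ := by funext i; fin_cases i <;> rfl
        simp only [Fin.zero_eta, pair_comp_zero, this]; exact hξ
      · have : ![ξ 0, η 0, ξ 1, η 1] ∘ pairEmb 1 = η := by funext i; fin_cases i <;> rfl
        simp only [Fin.mk_one, pair_comp_one, this]; exact hη
  rw [hc.fisher_eq star_mem_range_pairs, hξ.fisher_eq (star_mem_range_pair x),
    hη.fisher_eq (star_mem_range_pair y), tsum_fintype, tsum_fintype, tsum_fintype,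
    Fin.sum_univ_two, Fin.sum_univ_two, Fin.sum_univ_four]
  apply le_of_eq
  simp only [Matrix.cons_val]
  ring

theorem freePair_of_fisher_eq
    (h : S.fisher ![x, y, star x, star y] = S.fisher ![x, star x] + S.fisher ![y, star y])
    (hfin : S.fisher ![x, star x] + S.fisher ![y, star y] < ∞) : S.FreePair x y := by
  obtain ⟨ξ, hξ⟩ := S.exists_isConjugateSystem_of_fisher_ne_top (h ▸ hfin.ne)
  have hle : ∀ (B : Subalgebra ℂ A) ζ, ‖(S.closureL2 B).starProjection ζ‖ ^ 2 ≤ ‖ζ‖ ^ 2 :=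
    fun B ζ ↦ by gcongr; exact Submodule.norm_starProjection_apply_le _ _
  -- Each projected norm is at most the original one, so equality of the sums gives equality term by
  -- term; a vector whose projection has the same norm lies in the subspace.
  have hmem : ∀ i ∈ ({0, 2} : Finset (Fin 4)), ξ i ∈ S.closureL2 (S.alg ![x, star x]) := by
    rw [hξ.fisher_pair.1, hξ.fisher_pair.2, ENNReal.ofReal_eq_ofReal_iff (by positivity)
      (by positivity)] at h
    have h0 := hle (S.alg ![x, star x]) (ξ 0)
    have h2 := hle (S.alg ![x, star x]) (ξ 2)
    have h1 := hle (S.alg ![y, star y]) (ξ 1)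
    have h3 := hle (S.alg ![y, star y]) (ξ 3)
    intro i hi
    rw [Submodule.mem_iff_norm_starProjection, ← sq_eq_sq₀ (norm_nonneg _) (norm_nonneg _)]
    simp only [Finset.mem_insert, Finset.mem_singleton] at hi
    rcases hi with rfl | rfl <;> linarith
  obtain ⟨r, c, h1, h2, h3⟩ := S.conjugateRelations_iff.1 hξ.1
  -- The row and column of x* are those of x exchanged, so the balance terms of x and x* cancel.
  have hrc := S.corner_unique (h1 2).1 (h1 2).2 (S.star_mem_corner (h1 0).2)
  have halg : ∀ j, S.alg (![x, y, star x, star y] ∘ pairEmb j) =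
      (colourAlg pairColour d j).map (S.eval ![x, y, star x, star y]) :=
    fun j ↦ alg_comp_eq_map_colourAlg (pairColour_eq_iff j)
  have h0 := halg 0
  rw [pair_comp_zero] at h0
  have hfree := S.freeSubalgebras_of_conjRel (a := ![x, y, star x, star y]) (s := {0, 2})
    (κ := pairColour) (j₀ := 0) (fun i ↦ (h1 i).2) (by decide) (by decide)
    (fun b hb ↦ by
      rw [← h0] at hb ⊢; exact S.star_mem_alg (star_mem_range_pair x) hb)
    (fun i _ ↦ h3 i) (fun i hi ↦ h0 ▸ hmem i hi) (fun u ↦ by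
      rw [Finset.sum_pair (by decide), hrc.1, hrc.2]; ring)
  refine ⟨_, fun j ↦ ?_, hfree⟩
  rw [← halg]
  fin_cases j
  · simp only [Fin.zero_eta, pair_comp_zero]
    refine Set.pair_subset ?_ ?_
    · exact S.mem_alg (a := ![x, star x]) 0
    · exact S.mem_alg (a := ![x, star x]) 1
  · simp only [Fin.mk_one, pair_comp_one]
    refine Set.pair_subset ?_ ?_
    · exact S.mem_alg (a := ![y, star y]) 0
    · exact S.mem_alg (a := ![y, star y]) 1

end Pair

end RectSpace

end

theorem mainTheorem10 {A : Type*} [CStarAlgebra A] [PartialOrder A] [StarOrderedRing A]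
    [WStarAlgebra A] {d : ℕ} (S : RectSpace A d) {k l : Fin d} (hkl : k ≠ l) {x y : A}
    (hx : x ∈ S.corner k l) (hx0 : x ≠ 0) (hy : y ∈ S.corner k l) (hy0 : y ≠ 0) :
    S.fisher ![x, star x] + S.fisher ![y, star y] ≤ S.fisher ![x, y, star x, star y] ∧
    (S.FreePair x y →
      S.fisher ![x, y, star x, star y] = S.fisher ![x, star x] + S.fisher ![y, star y]) ∧
    (S.fisher ![x, y, star x, star y] = S.fisher ![x, star x] + S.fisher ![y, star y] →
      S.fisher ![x, star x] + S.fisher ![y, star y] < ⊤ → S.FreePair x y) :=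
  ⟨RectSpace.fisher_pair_le, fun h ↦ h.fisher_eq, RectSpace.freePair_of_fisher_eq⟩
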